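/- Let $d\in\mathbb C$, $d\ne 0$, and $Q=d^2$. All graphs are finite; loops, multiple edges, isolated vertices, several components and components that are simple closed curves are allowed. **Definitions.** - For a graph $\Gamma$, $\chi_\Gamma\in\mathbb C[X]$ is its chromatic polynomial, $\chi_\Gamma(Q)=\sum_{S\subset E(\Gamma)}(-1)^{|S|}Q^{k(S)}$, where $k(S)$ is the number of connected components of the graph with all vertices of $\Gamma$ and edge set $S$. - For a planar graph $G$, the dual graph $\widehat G$ has the complementary regions of $G$ as vertices and, for each edge of $G$, an edge between the regions on its two sides. - Let $\mathcal F_n$ be the complex vector space freely spanned by the isotopy classes of planar graphs in a rectangle $R$ which meet $\partial R$ in exactly $n$ endpoints at the top and $n$ at the bottom. The chromatic algebra $\mathcal C_n^Q$ is the quotient of $\mathcal F_n$ by the relations (1) $G=G/e-G\setminus e$ for an inner edge $e$ (no endpoint on $\partial R$) that is not a loop; (2) $G=(Q-1)\,G\setminus e$ for an inner edge $e$ that is a loop or a simple closed curve; (3) $G=0$ if $G$ has a $1$-valent vertex in the interior of $R$. - $\overline G$ is the planar graph obtained by joining the endpoints of $G$ at the top to those at the bottom by disjoint arcs outside $R$,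 and $tr_\chi(G)=Q^{-1}\chi_{\widehat{\overline G}}(Q)$. - $TL_{m}^d$ is the planar Temperley–Lieb algebra: the formal complex linear combinations of isotopy classes of $1$-dimensional submanifolds of $R$ with $m$ endpoints at the top and $m$ at the bottom, where a simple closed curve may be removed at the cost of a factor $d$. The trace $tr_d\colon TL^d_m\to\mathbb C$ sends a submanifold to $d^{\#\text{circles}}$, where the circles are those obtained by joining top and bottom endpoints by disjoint arcs outside $R$. - For a planar graph $G$ in $R$ with $n$ endpoints at the top and $n$ at the bottom, $\phi(G)\in TL_{2n}^d$ is obtained by doubling each edge and replacing it by the Jones–Wenzl projector $P_2$ (two parallel strands minus $\tfrac1d$ times two turn-backs), connecting neighbouring strands of consecutive edges at each interior vertex (an isolated vertex becomes a circle), and multiplying by $\prod_V d^{(r(V)-2)/2}$ over all interior vertices $V$, where $r(V)$ is the valency (the total exponent is an integer). **Lemma.** (a) For every planar graph $G$ (in the plane, that is, $n=0$), $$tr_\chi(G)=Q^{-1}\chi_{\widehat G}(Q)=tr_d(\phi(G)).$$ (b) For every $n\ge 0$, $\phi$ and $tr_\chi$ induce well-defined linear maps $\phi\colon\mathcal C^Q_n\to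 TL^d_{2n}$ and $tr_\chi\colon\mathcal C_n^Q\to\mathbb C$, and $$tr_d\circ\phi=tr_\chi .$$ In particular $Q^{-1}\chi_{\widehat{\overline G}}(Q)=tr_d(\phi(G))$ for every planar graph $G$ in $R$ with $n$ endpoints at the top and $n$ at the bottom. -/

import Mathlib

open Polynomial

noncomputable section

/-! ### Finite multigraphs and the chromatic polynomial -/

/-- A finite graph; loops and multiple edges are allowed. -/
structure Multigraph where
  V : Type
  E : Type
  [fintypeV : Fintype V]
  [fintypeE : Fintype E]
  ends : E → Sym2 V

attribute [instance] Multigraph.fintypeV Multigraph.fintypeE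

namespace Multigraph

variable (Γ : Multigraph)

/-- The number `k(S)` of connected components of the graph that has all the vertices of `Γ` and
the edges in `S`. -/
def components (S : Finset Γ.E) : ℕ :=
  Nat.card (Quot fun a b : Γ.V => ∃ e ∈ S, Γ.ends e = s(a, b))

/-- The chromatic polynomial `∑_S (-1)^{|S|} Q^{k(S)}`. The theorem
`chromaticPolynomial_eval_natCast` below says that its value at `m` is the number of proper
colourings with `m` colours. -/
def chromaticPolynomial : ℂ[X] :=
  ∑ S : Finset Γ.E, (-1) ^ S.card * X ^ Γ.components S

/-- Adjacent vertices have different colours (so there is none if `Γ` has a loop). -/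
def IsProperColoring {m : ℕ} (c : Γ.V → Fin m) : Prop :=
  ∀ e, ¬ ((Γ.ends e).map c).IsDiag

theorem card_monochromatic (m : ℕ) (S : Finset Γ.E) :
    Nat.card {c : Γ.V → Fin m // ∀ e ∈ S, ((Γ.ends e).map c).IsDiag} = m ^ Γ.components S := by
  classical
  have key : {c : Γ.V → Fin m // ∀ e ∈ S, ((Γ.ends e).map c).IsDiag} ≃
      ((Quot fun a b : Γ.V => ∃ e ∈ S, Γ.ends e = s(a, b)) → Fin m) :=
    { toFun := fun c => Quot.lift c.1 (by
        rintro a b ⟨e, he, hab⟩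
        have h := c.2 e he
        rw [hab] at h
        simpa using h)
      invFun := fun c => ⟨fun v => c (Quot.mk _ v), by
        intro e he
        induction hz : Γ.ends e using Sym2.ind with
        | _ a b =>
          simp only [Sym2.map_mk, Sym2.mk_isDiag_iff]
          exact congrArg c (Quot.sound ⟨e, he, hz⟩)⟩
      left_inv := fun c => rfl
      right_inv := fun c => by
        funext q
        induction q using Quot.ind
        rfl }
  rw [Nat.card_congr key, Nat.card_fun, Nat.card_fin]
  rfl

theorem chromaticPolynomial_eval_natCast (m : ℕ) :
    Γ.chromaticPolynomial.eval (m : ℂ) =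
      Nat.card {c : Γ.V → Fin m // Γ.IsProperColoring c} := by
  classical
  have h1 : ∀ S : Finset Γ.E, ((m : ℂ) ^ Γ.components S) =
      ∑ c : Γ.V → Fin m, ∏ e ∈ S, if ((Γ.ends e).map c).IsDiag then (1 : ℂ) else 0 := by
    intro S
    rw [← Nat.cast_pow, ← card_monochromatic, Nat.card_eq_fintype_card, Fintype.card_subtype,
      Finset.card_filter, Nat.cast_sum]
    refine Finset.sum_congr rfl fun c _ => ?_
    rw [Finset.prod_ite_zero]
    simp
  simp only [chromaticPolynomial, eval_finsetSum, eval_mul, eval_pow, eval_neg, eval_one, eval_X]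
  simp_rw [h1, Finset.mul_sum]
  rw [Finset.sum_comm, Nat.card_eq_fintype_card, Fintype.card_subtype, Finset.card_filter,
    Nat.cast_sum]
  refine Finset.sum_congr rfl fun c _ => ?_
  have h2 : ∀ S : Finset Γ.E, ((-1 : ℂ) ^ S.card *
      ∏ e ∈ S, if ((Γ.ends e).map c).IsDiag then (1 : ℂ) else 0) =
      ∏ e ∈ S, -(if ((Γ.ends e).map c).IsDiag then (1 : ℂ) else 0) := by
    intro S
    rw [Finset.prod_neg]
  simp_rw [h2]
  have h3 := Finset.prod_one_add (f := fun e : Γ.E =>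
    -(if ((Γ.ends e).map c).IsDiag then (1 : ℂ) else 0)) Finset.univ
  rw [Finset.powerset_univ] at h3
  rw [← h3]
  have h4 : ∀ e : Γ.E, (1 + -(if ((Γ.ends e).map c).IsDiag then (1 : ℂ) else 0)) =
      if ¬ ((Γ.ends e).map c).IsDiag then (1 : ℂ) else 0 := by
    intro e
    split_ifs <;> simp_all
  simp_rw [h4]
  rw [Finset.prod_ite_zero]
  by_cases h : Γ.IsProperColoring c
  · rw [if_pos (fun e _ => h e), if_pos h]
    simp
  · rw [if_neg (fun h' => h fun e => h' e (Finset.mem_univ e)), if_neg h]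
    simp

end Multigraph

/-! ### Graphs drawn on the sphere -/

/-- The combinatorial data of a finite graph drawn on an oriented surface. `E` is the set of
edges; `(e, true)` and `(e, false)` are the two *darts* of `e`, that is, `e` with either of its
two directions. `F` is the set of regions (the connected components of the complement). The graph
may be disconnected, and may have loops, multiple edges and isolated vertices. -/
structure Drawing where
  V : Type
  E : Type
  F : Type
  [fintypeV : Fintype V]
  [fintypeE : Fintype E]
  [fintypeF : Fintype F]
  /-- the vertex from which a dart starts -/
  vert : E × Bool → V
  /-- the next dart, counterclockwise, among those that start from the same vertex -/
  rot : Equiv.Perm (E × Bool)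
  /-- the region on the left of a dart -/
  region : E × Bool → F
  /-- the region in which an isolated vertex lies -/
  isoRegion : (v : V) → (∀ x, vert x ≠ v) → F

attribute [instance] Drawing.fintypeV Drawing.fintypeE Drawing.fintypeF

namespace Drawing

variable (M : Drawing)

/-- Darts; a dart is identified with its half of the edge near its starting point. -/
abbrev Dart : Type := M.E × Bool

variable {M} in
/-- The same edge with the other direction. The region on the right of `x` is
`M.region (flip x)`. -/
def flip (x : M.Dart) : M.Dart := (x.1, !x.2)

/-- The vertex `v` has valency `0`. -/
def IsIsolated (v : M.V) : Prop := ∀ x, M.vert x ≠ v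

/-- The valency of a vertex (a loop counts twice). -/
def valency (v : M.V) : ℕ := Nat.card {x : M.Dart // M.vert x = v}

/-- The vertex `v` lies on the boundary of the region `f`. -/
def Touches (v : M.V) (f : M.F) : Prop :=
  (∃ x, M.vert x = v ∧ M.region x = f) ∨ ∃ h : M.IsIsolated v, M.isoRegion v h = f

/-- The number of connected components of the graph. -/
def graphComponents : ℕ :=
  Nat.card (Quot fun a b : M.V => ∃ x, M.vert x = a ∧ M.vert (flip x) = b)

/-- The data describe a graph drawn on the sphere. The last two conditions say that vertices and
regions together make up one connected surface, and that Euler's formula for the sphere,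
`|V| - |E| + |F| = 1 + (number of components of the graph)`, holds. -/
structure IsSpherical : Prop where
  vert_rot : ∀ x, M.vert (M.rot x) = M.vert x
  sameCycle_of_vert_eq : ∀ x y, M.vert x = M.vert y → M.rot.SameCycle x y
  /-- the region on the left of `x` is the region on the right of the next dart -/
  region_corner : ∀ x, M.region (flip (M.rot x)) = M.region x
  connected : ∀ a b : M.V ⊕ M.F, Relation.EqvGen
    (fun a b => ∃ v f, M.Touches v f ∧ a = Sum.inl v ∧ b = Sum.inr f) a b
  euler : Fintype.card M.V + Fintype.card M.F = Fintype.card M.E + 1 + M.graphComponents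

end Drawing

/-! ### Planar graphs in a rectangle -/

/-- A planar graph in a rectangle `R` with `n` endpoints at the top and `n` at the bottom. The
exterior of `R` is shrunk to one vertex `outer` of a drawing on the sphere; the other vertices are
the (interior) vertices of the graph. The boundary points are numbered clockwise: those at the top
are `0, …, n - 1` from left to right, those at the bottom are `n, …, 2n - 1` from right to left,
and `leg i` is the dart that enters `R` at the point `i`. For `n = 0` this is a graph in the
plane.

A component which is a simple closed curve without vertices is recorded as a loop at an auxiliary
vertex `v` of valency `2`, distinguished by `IsCurve v`. -/
structure PlanarGraph (n : ℕ) extends Drawing where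
  spherical : toDrawing.IsSpherical
  outer : V
  leg : Fin (2 * n) → E × Bool
  leg_injective : Function.Injective leg
  vert_eq_outer_iff : ∀ x, vert x = outer ↔ ∃ i, leg i = x
  rot_leg : ∀ i, rot (leg i) = leg (finRotate (2 * n) i)
  IsCurve : V → Prop
  curve_ne_outer : ∀ v, IsCurve v → v ≠ outer
  curve_loop : ∀ v, IsCurve v → ∃ e : E, ∀ x : E × Bool, vert x = v ↔ x.1 = e

namespace PlanarGraph

variable {n : ℕ}

/-- An inner edge: both endpoints are in the interior of the rectangle. -/
def IsInner (G : PlanarGraph n) (e : G.E) : Prop := ∀ b, G.vert (e, b) ≠ G.outer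

/-- The edge `e` is a loop. -/
def IsLoop (G : PlanarGraph n) (e : G.E) : Prop := G.vert (e, true) = G.vert (e, false)

/-- Planar isotopy in the rectangle, relative to its boundary: an isomorphism of the drawings
which respects the orientation and the boundary points. -/
structure Isotopy (G H : PlanarGraph n) where
  onV : G.V ≃ H.V
  onDart : G.Dart ≃ H.Dart
  onF : G.F ≃ H.F
  flip_eq : ∀ x, onDart (Drawing.flip x) = Drawing.flip (onDart x)
  vert_eq : ∀ x, H.vert (onDart x) = onV (G.vert x)
  rot_eq : ∀ x, H.rot (onDart x) = onDart (G.rot x)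
  region_eq : ∀ x, H.region (onDart x) = onF (G.region x)
  touches_iff : ∀ v f, G.Touches v f ↔ H.Touches (onV v) (onF f)
  outer_eq : onV G.outer = H.outer
  leg_eq : ∀ i, onDart (G.leg i) = H.leg i
  curve_iff : ∀ v, G.IsCurve v ↔ H.IsCurve (onV v)

open Classical in
/-- Apply `jump` to `z` as long as it is a dart of the edge `e`, at most twice. -/
def skip (G : PlanarGraph n) (e : G.E) (jump : G.Dart → G.Dart) (z : G.Dart) : G.Dart :=
  if z.1 = e then (if (jump z).1 = e then jump (jump z) else jump z) else z

/-- `H` is `G \ e`. The cyclic orders at the vertices skip the darts of `e`, and the two regions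
along `e` are merged. If `e` is a simple closed curve, its auxiliary vertex is removed as well. -/
structure Deletion (G : PlanarGraph n) (e : G.E) (H : PlanarGraph n) where
  onDart : H.Dart → G.Dart
  onDart_injective : Function.Injective onDart
  range_onDart : ∀ x, (∃ y, onDart y = x) ↔ x.1 ≠ e
  onV : H.V → G.V
  onV_injective : Function.Injective onV
  range_onV : ∀ v, (∃ w, onV w = v) ↔ ¬ (G.IsCurve v ∧ G.vert (e, true) = v)
  onF : G.F → H.F
  onF_surjective : Function.Surjective onF
  onF_eq_iff : ∀ f g, onF f = onF g ↔
    f = g ∨ s(f, g) = s(G.region (e, true), G.region (e, false))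
  flip_eq : ∀ y, onDart (Drawing.flip y) = Drawing.flip (onDart y)
  vert_eq : ∀ y, onV (H.vert y) = G.vert (onDart y)
  rot_eq : ∀ y, onDart (H.rot y) = G.skip e G.rot (G.rot (onDart y))
  region_eq : ∀ y, H.region y = onF (G.region (onDart y))
  touches : ∀ w f, G.Touches (onV w) f → H.Touches w (onF f)
  outer_eq : onV H.outer = G.outer
  leg_eq : ∀ i, onDart (H.leg i) = G.leg i
  curve_iff : ∀ w, H.IsCurve w ↔ G.IsCurve (onV w)

/-- `H` is `G / e`, for an edge `e` which is not a loop. The two ends of `e` are merged; in the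
cyclic order at the new vertex, one passes from a dart of `e` to the opposite dart and then to the
next one at that end. -/
structure Contraction (G : PlanarGraph n) (e : G.E) (H : PlanarGraph n) where
  onDart : H.Dart → G.Dart
  onDart_injective : Function.Injective onDart
  range_onDart : ∀ x, (∃ y, onDart y = x) ↔ x.1 ≠ e
  onV : G.V → H.V
  onV_surjective : Function.Surjective onV
  onV_eq_iff : ∀ v w, onV v = onV w ↔
    v = w ∨ s(v, w) = s(G.vert (e, true), G.vert (e, false))
  onF : G.F ≃ H.F
  flip_eq : ∀ y, onDart (Drawing.flip y) = Drawing.flip (onDart y)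
  vert_eq : ∀ y, H.vert y = onV (G.vert (onDart y))
  rot_eq : ∀ y, onDart (H.rot y) =
    G.skip e (fun z => G.rot (Drawing.flip z)) (G.rot (onDart y))
  region_eq : ∀ y, H.region y = onF (G.region (onDart y))
  touches : ∀ v f, G.Touches v f → H.Touches (onV v) (onF f)
  outer_eq : H.outer = onV G.outer
  leg_eq : ∀ i, onDart (H.leg i) = G.leg i
  curve_iff : ∀ v, H.IsCurve (onV v) ↔ G.IsCurve v

/-- The dual graph: its vertices are the regions of the complement of `G`, and each edge of `G`
gives an edge between the regions on its two sides. -/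
def dual (G : PlanarGraph n) : Multigraph where
  V := G.F
  E := G.E
  ends e := s(G.region (e, true), G.region (e, false))

/-! The closure of `G` is obtained by joining the boundary points `i` and `2n - 1 - i` by disjoint
arcs outside the rectangle: the `i`-th point at the top is joined to the `i`-th one at the bottom.
-/

/-- Edges of `G` which become parts of the same edge of the closure. -/
inductive JoinedEdges (G : PlanarGraph n) : G.E → G.E → Prop
  | arc (i : Fin (2 * n)) : JoinedEdges G (G.leg i).1 (G.leg i.rev).1

/-- Regions of `G` which become parts of the same region of the closure: the left side of an arc
that leaves the rectangle at `2n - 1 - i` and enters it at `i` is adjacent to the region on the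
left of `leg i` and to the region on the right of `leg (2n - 1 - i)`. -/
inductive JoinedRegions (G : PlanarGraph n) : G.F → G.F → Prop
  | arc (i : Fin (2 * n)) :
      JoinedRegions G (G.region (G.leg i)) (G.region (Drawing.flip (G.leg i.rev)))

theorem sides_eq (G : PlanarGraph n) (x : G.Dart) :
    (s(Quot.mk G.JoinedRegions (G.region (x.1, true)),
      Quot.mk G.JoinedRegions (G.region (x.1, false))) : Sym2 (Quot G.JoinedRegions)) =
    s(Quot.mk G.JoinedRegions (G.region x),
      Quot.mk G.JoinedRegions (G.region (Drawing.flip x))) := by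
  obtain ⟨e, b⟩ := x
  cases b
  · exact Sym2.eq_swap
  · rfl

/-- The dual graph of the closure of `G`. -/
def closureDual (G : PlanarGraph n) : Multigraph :=
  letI := Fintype.ofFinite (Quot G.JoinedRegions)
  letI := Fintype.ofFinite (Quot G.JoinedEdges)
  { V := Quot G.JoinedRegions
    E := Quot G.JoinedEdges
    ends := Quot.lift
      (fun e => s(Quot.mk G.JoinedRegions (G.region (e, true)),
        Quot.mk G.JoinedRegions (G.region (e, false))))
      (by
        rintro _ _ ⟨i⟩
        rw [sides_eq, sides_eq]
        have h1 := Quot.sound (JoinedRegions.arc (G := G) i)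
        have h2 := Quot.sound (JoinedRegions.arc (G := G) i.rev)
        rw [Fin.rev_rev] at h2
        rw [h1, h2]
        exact Sym2.eq_swap) }

/-- The chromatic trace on the generators: `Q⁻¹` times the chromatic polynomial, at `Q`, of the
dual graph of the closure. -/
def chromaticTrace (Q : ℂ) (G : PlanarGraph n) : ℂ :=
  Q⁻¹ * G.closureDual.chromaticPolynomial.eval Q

end PlanarGraph

/-! ### The chromatic algebra -/

/-- Isotopy classes of planar graphs in the rectangle. -/
def GraphClass (n : ℕ) : Type 1 :=
  Quot fun G H : PlanarGraph n => Nonempty (G.Isotopy H)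

/-- The free vector space on the isotopy classes of planar graphs in the rectangle. -/
abbrev FreeGraphs (n : ℕ) : Type 1 := GraphClass n →₀ ℂ

/-- A graph as an element of the free vector space. -/
def PlanarGraph.toFree {n : ℕ} (G : PlanarGraph n) : FreeGraphs n :=
  Finsupp.single (Quot.mk _ G) 1

/-- The relations of the chromatic algebra. -/
inductive ChromaticRelation (Q : ℂ) {n : ℕ} : FreeGraphs n → Prop
  /-- `G = G / e - G \ e` for an inner edge `e` which is not a loop -/
  | contract_delete (G H K : PlanarGraph n) (e : G.E) (inner : G.IsInner e)
      (notLoop : ¬ G.IsLoop e) (contr : Nonempty (G.Contraction e H))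
      (del : Nonempty (G.Deletion e K)) :
      ChromaticRelation Q (G.toFree - (H.toFree - K.toFree))
  /-- `G = (Q - 1) (G \ e)` for an inner edge `e` which is a loop or a simple closed curve -/
  | loop (G K : PlanarGraph n) (e : G.E) (inner : G.IsInner e) (isLoop : G.IsLoop e)
      (del : Nonempty (G.Deletion e K)) :
      ChromaticRelation Q (G.toFree - (Q - 1) • K.toFree)
  /-- `G = 0` if `G` has a `1`-valent vertex in the interior of the rectangle -/
  | univalent (G : PlanarGraph n) (v : G.V) (interior : v ≠ G.outer)
      (univalent : G.valency v = 1) :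
      ChromaticRelation Q G.toFree

/-- The span of the relations. As the relations hold for all graphs in the rectangle, and stacking
a graph above or below a relation gives a relation, this is the ideal generated by them. -/
def chromaticIdeal (Q : ℂ) (n : ℕ) : Submodule ℂ (FreeGraphs n) :=
  Submodule.span ℂ {a | ChromaticRelation Q a}

/-- The (underlying vector space of the) chromatic algebra of degree `n` at the parameter `Q`. -/
abbrev ChromaticAlgebra (Q : ℂ) (n : ℕ) : Type 1 := FreeGraphs n ⧸ chromaticIdeal Q n

/-- The class of a planar graph in the chromatic algebra. -/
def PlanarGraph.toChromatic {n : ℕ} (Q : ℂ) (G : PlanarGraph n) : ChromaticAlgebra Q n :=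
  Submodule.Quotient.mk G.toFree

/-! ### The planar Temperley-Lieb algebra -/

/-- An equivalence relation on the `2m` boundary points of a rectangle (numbered in cyclic order)
which is a pairing of the points and can be realized by disjoint arcs in the rectangle. -/
structure IsPlanarPairing {m : ℕ} (p : Setoid (Fin (2 * m))) : Prop where
  pairing : ∀ a, ∃! b, b ≠ a ∧ p a b
  noncrossing : ∀ a b c d : Fin (2 * m), a < b → b < c → c < d → p a c → ¬ p b d

/-- The (underlying vector space of the) Temperley-Lieb algebra of degree `m` in its planar
presentation: formal linear combinations of planar pairings of the `2m` boundary points, that is,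
of systems of disjoint arcs up to isotopy. Simple closed curves in a picture are removed, each at
the cost of a factor `d`. It is the space of those formal linear combinations of
equivalence relations on the boundary points which involve planar pairings only. -/
def TemperleyLieb (m : ℕ) : Submodule ℂ (Setoid (Fin (2 * m)) →₀ ℂ) :=
  Finsupp.supported ℂ ℂ {p | IsPlanarPairing p}

/-- The number of circles which result when the boundary points `i` and `2m - 1 - i` are joined
by arcs outside the rectangle. -/
def closureLoops {m : ℕ} (p : Setoid (Fin (2 * m))) : ℕ :=
  Nat.card (Quot fun i j => p i j ∨ j = i.rev)

/-- The trace `tr_d`, which is `d` to the number of circles in the closure. -/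
def loopTrace (d : ℂ) (m : ℕ) : (Setoid (Fin (2 * m)) →₀ ℂ) →ₗ[ℂ] ℂ :=
  Finsupp.linearCombination ℂ fun p => d ^ closureLoops p

/-! ### The map from graphs to the Temperley-Lieb algebra -/

namespace PlanarGraph

variable {n : ℕ} (G : PlanarGraph n)

/-- Each edge is doubled to two strands. `(x, true)` and `(x, false)` are the ends of the strands
on the left and on the right of the dart `x`, near its starting point. -/
abbrev StrandEnd : Type := G.Dart × Bool

/-- How the ends of strands are connected, if the edges in `S` are replaced by two parallel
strands and the other ones by two turn-backs. At an interior vertex, neighbouring ends of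
strands that belong to consecutive darts are connected. -/
inductive Connected (S : Finset G.E) : G.StrandEnd → G.StrandEnd → Prop
  | parallel (x : G.Dart) (h : x.1 ∈ S) : Connected S (x, true) (Drawing.flip x, false)
  | turnBack (x : G.Dart) (h : x.1 ∉ S) : Connected S (x, true) (x, false)
  | corner (x : G.Dart) (h : G.vert x ≠ G.outer) : Connected S (x, true) (G.rot x, false)

/-- The point `i` on the boundary of the rectangle is doubled to the points `2 i`, `2 i + 1`; in
clockwise order, they are on the right and on the left of `leg i`. -/
def boundaryEnd (p : Fin (2 * (2 * n))) : G.StrandEnd :=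
  (G.leg ⟨p.1 / 2, by have := p.2; omega⟩, decide (p.1 % 2 = 1))

/-- Which of the `4n` boundary points are connected by the curves of the state `S`. -/
def statePairing (S : Finset G.E) : Setoid (Fin (2 * (2 * n))) :=
  Setoid.ker fun p => Quot.mk (G.Connected S) (G.boundaryEnd p)

/-- The number of simple closed curves of the state `S`. The resolution of an isolated vertex is
one circle around it. -/
def stateCircles (S : Finset G.E) : ℕ :=
  Nat.card {c : Quot (G.Connected S) // ∀ p, Quot.mk (G.Connected S) (G.boundaryEnd p) ≠ c} +
    Nat.card {v : G.V // v ≠ G.outer ∧ G.IsIsolated v}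

open Classical in
/-- The product of the factors `d ^ ((r - 2) / 2)` over all interior vertices, where `r` is the
valency. (The auxiliary vertex of a simple closed curve has `r = 2`.) -/
def vertexFactor (d : ℂ) : ℂ :=
  ∏ v ∈ Finset.univ.filter fun v : G.V => v ≠ G.outer, d ^ (((G.valency v : ℂ) - 2) / 2)

/-- `φ(G)`: each edge is replaced by the Jones-Wenzl projector, which is two parallel strands minus
`1 / d` times two turn-backs, and each interior vertex by its resolution times
`d ^ ((r - 2) / 2)`. -/
def phi (d : ℂ) : Setoid (Fin (2 * (2 * n))) →₀ ℂ :=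
  ∑ S : Finset G.E,
    (G.vertexFactor d * (-(1 / d)) ^ (Fintype.card G.E - S.card) * d ^ G.stateCircles S) •
      Finsupp.single (G.statePairing S) 1

end PlanarGraph

end

/-! Expanding every projector writes φ(G) as a sum over states S ⊆ E, with parallel strands on S and
turn-backs on T = E \ S. Let `rot` be the cyclic order of the darts at the vertices and `flipOn S`
the reversal of the darts of S. The curve on the left of a dart x continues on the left of `flipOn S
(rot x)`. Thus the curves of a state are orbits of `flipOn S * rot`, the boundary of a ribbon
neighbourhood of the subgraph (V, S), interrupted at the darts of the outer vertex; isolated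
vertices are counted apart. Everything reduces to counting orbits.

Trace. Closing up G splits the outer vertex into n vertices of valency two. If k is the number of
components of the dual graph with edge set T, Euler's formula turns the vertex factors and the
circles of the closed state into d ^ (|T| + 2k - 2). Together with (-1/d) ^ |T| this is (-1) ^ |T| Q
^ (k - 1), the term of T in Q⁻¹χ (`numClasses_closure`, `loopTrace_phi`).

Euler's formula for orbits comes from one elementary fact: composing a permutation with a
transposition changes the number of orbits by one. Iterating this gives the genus inequality
`euler_edges`, which applies to the graph and to its dual. The Euler formula in `IsSpherical` forces
equality (`isPlanar_and_card_regions`), and genus zero passes to subgraphs and to vertex splittings.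

Relations. For an edge e that is not a loop, the states containing e are those of G / e, and the
others are those of G \ e with sign -1. For a loop, planarity separates its two sides and makes one
of them a closed curve, so the states with e are -d² times those without. At a univalent vertex the
states cancel in pairs. Once φ is well defined, so is the chromatic trace, being the composite of
the loop trace with φ.

The pairings are noncrossing because two crossing arcs would allow the outer vertex to be rearranged
into a ribbon graph with more faces than Euler's inequality permits (`not_separated`). -/

noncomputable section

/-! ### Counting the classes of an equivalence relation -/

namespace Setoid

variable {α β ι : Type*}

/-- The equivalence relation generated by a relation. -/
abbrev gen (r : α → α → Prop) : Setoid α := Relation.EqvGen.setoid r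

/-- The number of equivalence classes. -/
def numClasses (s : Setoid α) : ℕ := Nat.card (Quotient s)

/-- The equivalence relation which identifies just `a` and `b`. -/
def pair (a b : α) : Setoid α := gen fun x y => x = a ∧ y = b

theorem gen_rel {r : α → α → Prop} {x y : α} (h : r x y) : gen r x y :=
  Relation.EqvGen.rel _ _ h

theorem gen_le {r : α → α → Prop} {s : Setoid α} : gen r ≤ s ↔ ∀ x y, r x y → s x y :=
  ⟨fun h _ _ hr => h (gen_rel hr), fun h => eqvGen_le h⟩

theorem pair_le {a b : α} {s : Setoid α} : pair a b ≤ s ↔ s a b := by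
  rw [pair, gen_le]
  exact ⟨fun h => h a b ⟨rfl, rfl⟩, by rintro h x y ⟨rfl, rfl⟩; exact h⟩

theorem pair_rel (a b : α) : pair a b a b := pair_le.1 le_rfl

theorem card_quot (r : α → α → Prop) : Nat.card (Quot r) = numClasses (gen r) := by
  refine Nat.card_congr
    { toFun := Quot.lift (fun x => (Quotient.mk (gen r) x)) fun a b h => Quotient.sound (gen_rel h)
      invFun := Quotient.lift (Quot.mk r) fun a b h => Quot.eqvGen_sound h
      left_inv := fun q => by induction q using Quot.ind; rfl
      right_inv := fun q => by induction q using Quotient.ind; rfl }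

theorem numClasses_ker (f : α → β) : numClasses (ker f) = (Set.range f).ncard := by
  rw [numClasses, Nat.card_congr (quotientKerEquivRange f), Nat.card_coe_set_eq]

theorem numClasses_ker_of_surjective {f : α → β} (h : f.Surjective) :
    numClasses (ker f) = Nat.card β := by
  rw [numClasses_ker, h.range_eq, Set.ncard_univ]

theorem numClasses_le_of_le [Finite α] {s t : Setoid α} (h : s ≤ t) : numClasses t ≤ numClasses s :=
  Nat.card_le_card_of_surjective (Quotient.map id fun _ _ hab => h hab) fun q => by
    induction q using Quotient.ind with
    | _ a => exact ⟨Quotient.mk _ a, rfl⟩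

theorem eq_of_le_of_numClasses_le [Finite α] {s t : Setoid α} (h : s ≤ t)
    (hc : numClasses s ≤ numClasses t) : s = t := by
  refine le_antisymm h fun a b hab => ?_
  let f : Quotient s → Quotient t := Quotient.map id fun _ _ hab => h hab
  have hf : f.Surjective := fun q => by
    induction q using Quotient.ind with
    | _ a => exact ⟨Quotient.mk _ a, rfl⟩
  have hb := (Nat.bijective_iff_surjective_and_card f).2
    ⟨hf, le_antisymm hc (numClasses_le_of_le h)⟩
  exact Quotient.exact (hb.1 (Quotient.sound hab : f (Quotient.mk _ a) = f (Quotient.mk _ b)))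

theorem numClasses_comap_of_surjective {f : α → β} (hf : f.Surjective) (s : Setoid β) :
    numClasses (comap f s) = numClasses s := by
  have h : comap f s = ker fun x => (Quotient.mk s (f x)) := by
    ext x y
    exact (Quotient.eq (r := s)).symm
  rw [h]
  exact numClasses_ker_of_surjective (Quotient.mk_surjective.comp hf)

-- An explicit model of the join, with the class of `a` redirected to that of `b`; it makes the loss
-- of exactly one class visible.
open Classical in
theorem sup_pair_eq_ker (s : Setoid α) (a b : α) :
    s ⊔ pair a b = ker fun x => if s x a then (Quotient.mk s b) else Quotient.mk s x := by
  refine le_antisymm (sup_le (fun x y hxy => ?_) (pair_le.2 ?_)) fun x y hxy => ?_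
  · have : s x a ↔ s y a := ⟨s.trans (s.symm hxy), s.trans hxy⟩
    simp only [ker_def, this]
    split_ifs
    · rfl
    · exact Quotient.sound hxy
  · simp only [ker_def, s.refl a, if_true]
    split_ifs <;> rfl
  · have key : ∀ z, ∃ w, (s ⊔ pair a b) z w ∧
        (if s z a then (Quotient.mk s b) else Quotient.mk s z) = Quotient.mk s w := by
      intro z
      split_ifs with hz
      · exact ⟨b, (s ⊔ pair a b).trans ((le_sup_left : s ≤ _) hz)
          ((le_sup_right : pair a b ≤ _) (pair_rel a b)), rfl⟩
      · exact ⟨z, (s ⊔ pair a b).refl z, rfl⟩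
    obtain ⟨u, hu, hu'⟩ := key x
    obtain ⟨v, hv, hv'⟩ := key y
    rw [ker_def, hu', hv'] at hxy
    exact (s ⊔ pair a b).trans hu ((s ⊔ pair a b).trans
      ((le_sup_left : s ≤ _) (Quotient.exact hxy)) ((s ⊔ pair a b).symm hv))

theorem sup_pair_of_rel {s : Setoid α} {a b : α} (h : s a b) : s ⊔ pair a b = s :=
  sup_eq_left.2 (pair_le.2 h)

theorem numClasses_eq_sup_pair_add_one [Finite α] {s : Setoid α} {a b : α} (h : ¬ s a b) :
    numClasses s = numClasses (s ⊔ pair a b) + 1 := by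
  classical
  rw [sup_pair_eq_ker, numClasses_ker]
  have : (Set.range fun x => if s x a then (Quotient.mk s b) else Quotient.mk s x) =
      {Quotient.mk s a}ᶜ := by
    ext q
    simp only [Set.mem_range, Set.mem_compl_iff, Set.mem_singleton_iff]
    constructor
    · rintro ⟨x, rfl⟩ hx
      split_ifs at hx with hxa
      · exact h (s.symm (Quotient.exact hx))
      · exact hxa (Quotient.exact hx)
    · intro hq
      induction q using Quotient.ind with
      | _ x =>
        refine ⟨x, if_neg fun hx => hq (Quotient.sound hx)⟩
  have hc := Set.ncard_add_ncard_compl {Quotient.mk s a}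
  rw [this, numClasses, ← hc, Set.ncard_singleton, add_comm]

theorem numClasses_eq_one [Nonempty α] {s : Setoid α} (h : ∀ a b, s a b) : numClasses s = 1 := by
  rw [numClasses, Nat.card_eq_one_iff_unique]
  exact ⟨⟨fun p q => by
    induction p using Quotient.ind
    induction q using Quotient.ind
    exact Quotient.sound (h _ _)⟩, ⟨Quotient.mk _ (Classical.arbitrary α)⟩⟩

/-- The classes that do not meet the range of `f`. -/
def freeClasses (s : Setoid α) (f : ι → α) : ℕ :=
  Nat.card {c : Quotient s // ∀ i, Quotient.mk s (f i) ≠ c}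

theorem freeClasses_add_numClasses_comap [Finite α] (s : Setoid α) (f : ι → α) :
    freeClasses s f + numClasses (comap f s) = numClasses s := by
  have h : comap f s = ker fun x => (Quotient.mk s (f x)) := by
    ext x y
    exact (Quotient.eq (r := s)).symm
  rw [h, numClasses_ker, freeClasses, numClasses,
    ← Set.ncard_add_ncard_compl (Set.range fun x => (Quotient.mk s (f x))), add_comm]
  congr 1
  rw [← Nat.card_coe_set_eq]
  refine Nat.card_congr (Equiv.subtypeEquivRight fun c => ?_)
  simp

/-- Adding relations `t` between the points `f i` identifies classes that meet the range
of `f`. -/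
theorem numClasses_sup_gen_map [Finite α] [Finite ι] (s : Setoid α) (f : ι → α)
    (t : ι → ι → Prop) :
    numClasses (s ⊔ gen fun x y => ∃ i j, t i j ∧ f i = x ∧ f j = y) =
      freeClasses s f + numClasses (comap f s ⊔ gen t) := by
  classical
  set T := s ⊔ gen fun x y => ∃ i j, t i j ∧ f i = x ∧ f j = y with hT
  have hsT : s ≤ T := le_sup_left
  have hle : comap f s ⊔ gen t ≤ comap f T :=
    sup_le (fun i j h => hsT h)
      (gen_le.2 fun i j h => (le_sup_right : gen _ ≤ T) (gen_rel ⟨i, j, h, rfl, rfl⟩))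
  -- A class that meets the range of `f` is recorded by an index of one of its points, and any other
  -- class by itself.
  let g : α → {c : Quotient s // ∀ i, Quotient.mk s (f i) ≠ c} ⊕ Quotient (comap f s ⊔ gen t) :=
    fun x => if h : ∃ i, s x (f i) then Sum.inr (Quotient.mk _ h.choose) else
      Sum.inl ⟨Quotient.mk s x, fun i hi => h ⟨i, s.symm (Quotient.exact hi)⟩⟩
  have hg1 : ∀ x i, s x (f i) → g x = Sum.inr (Quotient.mk _ i) := by
    intro x i h
    have h' : ∃ i, s x (f i) := ⟨i, h⟩
    simp only [g, dif_pos h']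
    refine congrArg Sum.inr (Quotient.sound ((le_sup_left : comap f s ≤ _) ?_))
    exact s.trans (s.symm h'.choose_spec) h
  have hg2 : ∀ x (h : ¬ ∃ i, s x (f i)), g x = Sum.inl ⟨Quotient.mk s x, fun i hi =>
      h ⟨i, s.symm (Quotient.exact hi)⟩⟩ := fun x h => dif_neg h
  have hker : T = ker g := by
    refine le_antisymm (sup_le (fun x y h => ?_) (gen_le.2 ?_)) fun x y h => ?_
    · rw [ker_def]
      by_cases hx : ∃ i, s x (f i)
      · obtain ⟨i, hi⟩ := hx
        rw [hg1 x i hi, hg1 y i (s.trans (s.symm h) hi)]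
      · have hy : ¬ ∃ i, s y (f i) := fun ⟨i, hi⟩ => hx ⟨i, s.trans h hi⟩
        rw [hg2 x hx, hg2 y hy]
        exact congrArg Sum.inl (Subtype.ext (Quotient.sound h))
    · rintro _ _ ⟨i, j, hij, rfl, rfl⟩
      rw [ker_def, hg1 _ i (s.refl _), hg1 _ j (s.refl _)]
      exact congrArg Sum.inr (Quotient.sound ((le_sup_right : gen t ≤ _) (gen_rel hij)))
    · rw [ker_def] at h
      by_cases hx : ∃ i, s x (f i)
      · obtain ⟨i, hi⟩ := hx
        by_cases hy : ∃ i, s y (f i)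
        · obtain ⟨j, hj⟩ := hy
          rw [hg1 x i hi, hg1 y j hj] at h
          exact T.trans (hsT hi) (T.trans (hle (Quotient.exact (Sum.inr_injective h)))
            (T.symm (hsT hj)))
        · rw [hg1 x i hi, hg2 y hy] at h
          cases h
      · by_cases hy : ∃ i, s y (f i)
        · obtain ⟨j, hj⟩ := hy
          rw [hg1 y j hj, hg2 x hx] at h
          cases h
        · rw [hg2 x hx, hg2 y hy] at h
          exact hsT (Quotient.exact (congrArg Subtype.val (Sum.inl_injective h)))
  have hsurj : g.Surjective := by
    rintro (⟨c, hc⟩ | q)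
    · induction c using Quotient.ind with
      | _ x =>
        have hx : ¬ ∃ i, s x (f i) := fun ⟨i, hi⟩ => hc i (Quotient.sound (s.symm hi))
        exact ⟨x, hg2 x hx⟩
    · induction q using Quotient.ind with
      | _ i => exact ⟨f i, hg1 _ i (s.refl _)⟩
  rw [hker, numClasses_ker_of_surjective hsurj, Nat.card_sum]
  rfl

end Setoid

/-! ### Orbits of permutations and Euler's inequality -/

namespace Setoid

open Equiv

variable {D F : Type*}

/-- The equivalence relation generated by `x ∼ f x` for `x ∉ O`. -/
def flow (f : D → D) (O : Set D) : Setoid D := gen fun x y => x ∉ O ∧ f x = y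

theorem flow_rel {f : D → D} {O : Set D} {x : D} (h : x ∉ O) : flow f O x (f x) :=
  gen_rel ⟨h, rfl⟩

theorem flow_le {f : D → D} {O : Set D} {s : Setoid D} :
    flow f O ≤ s ↔ ∀ x, x ∉ O → s x (f x) := by
  rw [flow, gen_le]
  exact ⟨fun h x hx => h x _ ⟨hx, rfl⟩, by rintro h x _ ⟨hx, rfl⟩; exact h x hx⟩

/-- The partition into the orbits of `f`. -/
def orb (f : D → D) : Setoid D := flow f ∅

theorem orb_rel (f : D → D) (x : D) : orb f x (f x) := flow_rel (Set.notMem_empty x)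

theorem orb_le {f : D → D} {s : Setoid D} : orb f ≤ s ↔ ∀ x, s x (f x) := by
  rw [orb, flow_le]
  exact ⟨fun h x => h x (Set.notMem_empty x), fun h x _ => h x⟩

theorem flow_le_orb (f : D → D) (O : Set D) : flow f O ≤ orb f :=
  flow_le.2 fun x _ => orb_rel f x

theorem orb_iterate (f : D → D) (x : D) (k : ℕ) : orb f x (f^[k] x) := by
  induction k with
  | zero => exact (orb f).refl x
  | succ k ih =>
    rw [Function.iterate_succ_apply']
    exact (orb f).trans ih (orb_rel f _)

theorem flow_iterate {f : D → D} {O : Set D} {x : D} {k : ℕ} (h : ∀ i < k, f^[i] x ∉ O) :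
    flow f O x (f^[k] x) := by
  induction k with
  | zero => exact (flow f O).refl x
  | succ k ih =>
    rw [Function.iterate_succ_apply']
    exact (flow f O).trans (ih fun i hi => h i (by omega)) (flow_rel (h k (by omega)))

theorem exists_iterate_eq_self [Finite D] (π : Perm D) (x : D) : ∃ k, π^[k + 1] x = x := by
  have h := isOfFinOrder_of_finite π
  refine ⟨orderOf π - 1, ?_⟩
  rw [Nat.sub_add_cancel h.orderOf_pos, ← Perm.coe_pow, pow_orderOf_eq_one]
  rfl

/-- Finiteness makes reachability by forward iteration symmetric, since a backward step is a
positive power of `π`. -/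
theorem iterate_surjOn_orb [Finite D] (π : Perm D) {x y : D} (h : orb π x y) :
    ∃ k, π^[k] x = y := by
  let A : Setoid D :=
    { r := fun x y => ∃ k, π^[k] x = y
      iseqv :=
        { refl := fun x => ⟨0, rfl⟩
          symm := by
            rintro x _ ⟨k, rfl⟩
            have hpow : ∀ m, π^[m] = ⇑(π ^ m) := fun m => (Perm.coe_pow π m).symm
            refine ⟨(orderOf π - 1) * k, ?_⟩
            rw [← Function.iterate_add_apply, hpow]
            have : (orderOf π - 1) * k + k = orderOf π * k := by
              obtain ⟨m, hm⟩ := Nat.exists_eq_add_of_lt (isOfFinOrder_of_finite π).orderOf_pos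
              rw [hm]; simp; ring
            rw [this, pow_mul, pow_orderOf_eq_one, one_pow]
            rfl
          trans := by
            rintro x _ _ ⟨k, rfl⟩ ⟨l, rfl⟩
            exact ⟨l + k, Function.iterate_add_apply _ _ _ _⟩ } }
  have hle : orb π ≤ A := orb_le.2 fun x => ⟨1, rfl⟩
  exact hle h

/-! ### Permutations composed with a transposition -/

theorem orb_swap_mul_sup_pair [DecidableEq D] (π : Perm D) (a b : D) :
    orb (swap a b * π) ⊔ pair a b = orb π ⊔ pair a b := by
  have key : ∀ (π : Perm D), orb (swap a b * π) ≤ orb π ⊔ pair a b := by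
    intro π
    refine orb_le.2 fun x => ?_
    have hp := (le_sup_right : pair a b ≤ orb π ⊔ pair a b) (pair_rel a b)
    have hx := (le_sup_left : orb π ≤ orb π ⊔ pair a b) (orb_rel π x)
    refine Setoid.trans' _ hx ?_
    rw [Perm.mul_apply]
    rcases eq_or_ne (π x) a with h | h
    · rw [h, swap_apply_left]; exact hp
    · rcases eq_or_ne (π x) b with h' | h'
      · rw [h', swap_apply_right]; exact Setoid.symm' _ hp
      · rw [swap_apply_of_ne_of_ne h h']
  refine le_antisymm (sup_le (key π) le_sup_right) (sup_le ?_ le_sup_right)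
  have := key (swap a b * π)
  rwa [swap_mul_self_mul] at this

/-- Follow the orbit of `a` until its first return. The orbit avoids `b`, so only the closing step
changes: it is redirected from `a` to `b`. -/
theorem orb_swap_mul_of_not_orb [Finite D] [DecidableEq D] {π : Perm D} {a b : D}
    (h : ¬ orb π a b) : orb (swap a b * π) a b := by
  classical
  have hex := exists_iterate_eq_self π a
  let m := Nat.find hex
  have hm : π^[m + 1] a = a := Nat.find_spec hex
  have hlt : ∀ i < m, π^[i + 1] a ≠ a := fun i hi => Nat.find_min hex hi
  have hne : ∀ i, π^[i] a ≠ b := fun i hi => h (hi ▸ orb_iterate π a i)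
  have step : ∀ i ≤ m, orb (swap a b * π) a (π^[i] a) := by
    intro i
    induction i with
    | zero => intro _; exact Setoid.refl' _ _
    | succ i ih =>
      intro hi
      have h1 := orb_rel (swap a b * π) (π^[i] a)
      rw [Perm.mul_apply, ← Function.iterate_succ_apply' π,
        swap_apply_of_ne_of_ne (hlt i (by omega)) (hne _)] at h1
      exact Setoid.trans' _ (ih (by omega)) h1
  have h1 := orb_rel (swap a b * π) (π^[m] a)
  rw [Perm.mul_apply, ← Function.iterate_succ_apply' π, hm, swap_apply_left] at h1
  exact Setoid.trans' _ (step m le_rfl) h1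

/-- The stretch of the orbit from `a` up to, but excluding, `b` becomes invariant, because the step
into `b` is redirected to `a`. -/
theorem not_orb_swap_mul_of_orb [Finite D] [DecidableEq D] {π : Perm D} {a b : D} (hab : a ≠ b)
    (h : orb π a b) : ¬ orb (swap a b * π) a b := by
  classical
  have hex := iterate_surjOn_orb π h
  let k := Nat.find hex
  have hk : π^[k] a = b := Nat.find_spec hex
  have hlt : ∀ i < k, π^[i] a ≠ b := fun i hi => Nat.find_min hex hi
  have hk0 : k ≠ 0 := fun h0 => hab (by rw [← hk, h0]; rfl)
  -- A return to `a` at time `i` would make `b` appear already at time `k - i`.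
  have hne : ∀ i < k, i ≠ 0 → π^[i] a ≠ a := by
    intro i hi h0 hia
    refine hlt (k - i) (by omega) ?_
    rw [← hk]
    conv_rhs => rw [show k = k - i + i by omega, Function.iterate_add_apply, hia]
  let A : Set D := {x | ∃ i < k, π^[i] a = x}
  have hmaps : ∀ x ∈ A, (swap a b * π) x ∈ A := by
    rintro _ ⟨i, hi, rfl⟩
    rw [Perm.mul_apply, ← Function.iterate_succ_apply' π]
    rcases Nat.lt_or_ge (i + 1) k with h1 | h1
    · rw [swap_apply_of_ne_of_ne (hne _ h1 (by omega)) (hlt _ h1)]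
      exact ⟨i + 1, h1, rfl⟩
    · rw [show i.succ = k by omega, hk, swap_apply_right]
      exact ⟨0, by omega, rfl⟩
  have hle : orb (swap a b * π) ≤ ker fun x => x ∈ A := by
    refine orb_le.2 fun x => propext ⟨hmaps x, fun hx => ?_⟩
    have hit : ∀ m y, y ∈ A → (swap a b * π)^[m] y ∈ A := by
      intro m
      induction m with
      | zero => exact fun y hy => hy
      | succ m ih => exact fun y hy => ih _ (hmaps y hy)
    obtain ⟨m, hm⟩ := exists_iterate_eq_self (swap a b * π) x
    have := hit m _ hx
    rwa [← Function.iterate_succ_apply, hm] at this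
  have ha : a ∈ A := ⟨0, by omega, rfl⟩
  intro h'
  have : a ∈ A ↔ b ∈ A := iff_of_eq (hle h')
  obtain ⟨i, hi, hib⟩ := this.1 ha
  exact hlt i hi hib

theorem numClasses_orb_swap_mul_of_orb [Finite D] [DecidableEq D] {π : Perm D} {a b : D}
    (hab : a ≠ b) (h : orb π a b) :
    (orb (swap a b * π)).numClasses = (orb π).numClasses + 1 := by
  rw [numClasses_eq_sup_pair_add_one (not_orb_swap_mul_of_orb hab h), orb_swap_mul_sup_pair,
    sup_pair_of_rel h]

theorem numClasses_orb_swap_mul_of_not_orb [Finite D] [DecidableEq D] {π : Perm D} {a b : D}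
    (h : ¬ orb π a b) :
    (orb π).numClasses = (orb (swap a b * π)).numClasses + 1 := by
  rw [numClasses_eq_sup_pair_add_one h, ← orb_swap_mul_sup_pair,
    sup_pair_of_rel (orb_swap_mul_of_not_orb h)]

theorem orb_apply_apply (π : Perm D) (a b : D) : orb π (π a) (π b) ↔ orb π a b :=
  ⟨fun h => Setoid.trans' _ (orb_rel π a) (Setoid.trans' _ h (Setoid.symm' _ (orb_rel π b))),
    fun h => Setoid.trans' _ (Setoid.symm' _ (orb_rel π a)) (Setoid.trans' _ h (orb_rel π b))⟩

theorem numClasses_orb_mul_swap_of_orb [Finite D] [DecidableEq D] {π : Perm D} {a b : D}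
    (hab : a ≠ b) (h : orb π a b) :
    (orb (π * swap a b)).numClasses = (orb π).numClasses + 1 := by
  rw [mul_swap_eq_swap_mul]
  exact numClasses_orb_swap_mul_of_orb (π.injective.ne hab) ((orb_apply_apply π a b).2 h)

theorem numClasses_orb_mul_swap_of_not_orb [Finite D] [DecidableEq D] {π : Perm D} {a b : D}
    (h : ¬ orb π a b) :
    (orb π).numClasses = (orb (π * swap a b)).numClasses + 1 := by
  rw [mul_swap_eq_swap_mul]
  exact numClasses_orb_swap_mul_of_not_orb (mt (orb_apply_apply π a b).1 h)

theorem orb_mul_swap_of_not_orb [Finite D] [DecidableEq D] {π : Perm D} {a b : D}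
    (h : ¬ orb π a b) : orb (π * swap a b) a b := by
  have h1 := orb_swap_mul_of_not_orb (mt (orb_apply_apply π a b).1 h)
  rw [← mul_swap_eq_swap_mul] at h1
  rw [← orb_apply_apply, Perm.mul_apply, Perm.mul_apply, swap_apply_left, swap_apply_right]
  exact Setoid.symm' _ h1

theorem orb_mul_swap_sup_pair [DecidableEq D] (π : Perm D) (a b : D) :
    orb (π * swap a b) ⊔ pair a b = orb π ⊔ pair a b := by
  have key : ∀ (π : Perm D), orb (π * swap a b) ≤ orb π ⊔ pair a b := by
    intro π
    refine orb_le.2 fun x => ?_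
    have hp := (le_sup_right : pair a b ≤ orb π ⊔ pair a b) (pair_rel a b)
    have hx := fun x => (le_sup_left : orb π ≤ orb π ⊔ pair a b) (orb_rel π x)
    rw [Perm.mul_apply]
    rcases eq_or_ne x a with rfl | h
    · rw [swap_apply_left]; exact Setoid.trans' _ hp (hx _)
    · rcases eq_or_ne x b with rfl | h'
      · rw [swap_apply_right]; exact Setoid.trans' _ (Setoid.symm' _ hp) (hx _)
      · rw [swap_apply_of_ne_of_ne h h']; exact hx _
  refine le_antisymm (sup_le (key π) le_sup_right) (sup_le ?_ le_sup_right)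
  have := key (π * swap a b)
  rwa [mul_assoc, swap_mul_self, mul_one] at this

/-- Joining the classes of two points and composing with their transposition does not decrease
`2 · #classes - #orbits + #steps`. -/
theorem euler_step [Finite D] [DecidableEq D] [Finite F] (π : Perm D)
    {K : Setoid F} {r : D → F} (h : orb π ≤ comap r K)
    {a b : D} (hab : a ≠ b) :
    2 * K.numClasses + (orb (swap a b * π)).numClasses ≤
      2 * (K ⊔ pair (r a) (r b)).numClasses + (orb π).numClasses + 1 := by
  -- If the classes agree already, only the number of orbits changes, by one in either direction.
  -- Otherwise the orbits differ too, and one class and one orbit are lost.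
  by_cases hK : K (r a) (r b)
  · rw [sup_pair_of_rel hK]
    by_cases ho : orb π a b
    · rw [numClasses_orb_swap_mul_of_orb hab ho]; omega
    · have := numClasses_orb_swap_mul_of_not_orb ho
      omega
  · have h1 := numClasses_eq_sup_pair_add_one hK
    have h2 := numClasses_orb_swap_mul_of_not_orb fun ho => hK (h ho)
    omega

/-- Preserves the hypothesis of `euler_step`, so that the step can be iterated. -/
theorem euler_step_invariant [DecidableEq D] {π : Perm D}
    {K : Setoid F} {r : D → F} (h : orb π ≤ comap r K)
    (a b : D) : orb (swap a b * π) ≤ comap r (K ⊔ pair (r a) (r b)) := by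
  have h1 : orb (swap a b * π) ≤ orb π ⊔ pair a b :=
    orb_swap_mul_sup_pair π a b ▸ le_sup_left
  refine h1.trans (sup_le (fun x y hxy => (le_sup_left : K ≤ _) (h hxy)) (pair_le.2 ?_))
  exact (le_sup_right : pair (r a) (r b) ≤ _) (pair_rel _ _)

theorem sup_pair_congr {K : Setoid F} {a b a' b' : F} (ha : K a a') (hb : K b b') :
    K ⊔ pair a b = K ⊔ pair a' b' := by
  have key : ∀ {a b a' b' : F}, K a a' → K b b' → K ⊔ pair a b ≤ K ⊔ pair a' b' := by
    intro a b a' b' ha hb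
    refine sup_le le_sup_left (pair_le.2 ?_)
    have hl : K ≤ K ⊔ pair a' b' := le_sup_left
    exact Setoid.trans' _ (hl ha) (Setoid.trans' _
      ((le_sup_right : pair a' b' ≤ _) (pair_rel _ _)) (Setoid.symm' _ (hl hb)))
  exact le_antisymm (key ha hb) (key (K.symm ha) (K.symm hb))

theorem euler_step_right [Finite D] [DecidableEq D] [Finite F] (π : Perm D)
    {K : Setoid F} {r : D → F}
    (h : orb π ≤ comap r K) {a b : D} (hab : a ≠ b) :
    2 * K.numClasses + (orb (π * swap a b)).numClasses ≤
      2 * (K ⊔ pair (r a) (r b)).numClasses + (orb π).numClasses + 1 := by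
  have := euler_step π h (π.injective.ne hab)
  rwa [← mul_swap_eq_swap_mul,
    ← sup_pair_congr (K := K) (h (orb_rel π a)) (h (orb_rel π b))] at this

theorem euler_step_right_invariant [DecidableEq D] {π : Perm D} {K : Setoid F} {r : D → F}
    (h : orb π ≤ comap r K) (a b : D) :
    orb (π * swap a b) ≤ comap r (K ⊔ pair (r a) (r b)) := by
  have := euler_step_invariant h (π a) (π b)
  rwa [← mul_swap_eq_swap_mul,
    ← sup_pair_congr (K := K) (h (orb_rel π a)) (h (orb_rel π b))] at this

end Setoid

/-! ### Ribbon graphs: edge flips, genus -/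

namespace Ribbon

open Equiv Setoid
open scoped Classical

variable {E F : Type*}

/-- The reversal of the darts of the edges in `S`. -/
def flipOn (S : Finset E) : Perm (E × Bool) where
  toFun x := (x.1, if x.1 ∈ S then !x.2 else x.2)
  invFun x := (x.1, if x.1 ∈ S then !x.2 else x.2)
  left_inv x := by
    by_cases h : x.1 ∈ S <;> simp [h]
  right_inv x := by
    by_cases h : x.1 ∈ S <;> simp [h]

theorem flipOn_of_mem {S : Finset E} {x : E × Bool} (h : x.1 ∈ S) :
    flipOn S x = (x.1, !x.2) := by
  simp [flipOn, h]

theorem flipOn_of_notMem {S : Finset E} {x : E × Bool} (h : x.1 ∉ S) : flipOn S x = x := by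
  simp [flipOn, h]

@[simp]
theorem flipOn_fst (S : Finset E) (x : E × Bool) : (flipOn S x).1 = x.1 := rfl

@[simp]
theorem flipOn_flipOn (S : Finset E) (x : E × Bool) : flipOn S (flipOn S x) = x :=
  (flipOn S).left_inv x

theorem flipOn_eq_iff (S : Finset E) {x y : E × Bool} : flipOn S x = y ↔ x = flipOn S y :=
  ⟨fun h => by rw [← h, flipOn_flipOn], fun h => by rw [h, flipOn_flipOn]⟩

theorem flipOn_mul_flipOn (S : Finset E) : flipOn S * flipOn S = 1 :=
  Equiv.ext (flipOn_flipOn S)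

@[simp]
theorem flipOn_empty : flipOn (∅ : Finset E) = 1 := by
  ext x <;> simp [flipOn]

/-- Adding an edge is composition with one transposition, so `euler_step` applies edge by edge. -/
theorem flipOn_insert {e : E} {S : Finset E} (h : e ∉ S) :
    flipOn (insert e S) = swap (e, true) (e, false) * flipOn S := by
  refine Equiv.ext fun x => ?_
  obtain ⟨a, b⟩ := x
  rw [Perm.mul_apply]
  by_cases hae : a = e
  · subst hae
    rw [flipOn_of_mem (by simp), flipOn_of_notMem h]
    cases b <;> simp
  · have hne : ∀ c, flipOn S (a, b) ≠ (e, c) := fun c hc => hae (congrArg Prod.fst hc)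
    rw [swap_apply_of_ne_of_ne (hne _) (hne _)]
    simp [flipOn, hae]

/-- The identification of the two sides of each edge in `S`. -/
def edgeSetoid (r : E × Bool → F) (S : Finset E) : Setoid F :=
  gen fun f g => ∃ e ∈ S, r (e, true) = f ∧ r (e, false) = g

theorem edgeSetoid_le {r : E × Bool → F} {S : Finset E} {s : Setoid F} :
    edgeSetoid r S ≤ s ↔ ∀ e ∈ S, s (r (e, true)) (r (e, false)) := by
  rw [edgeSetoid, gen_le]
  exact ⟨fun h e he => h _ _ ⟨e, he, rfl, rfl⟩, by rintro h _ _ ⟨e, he, rfl, rfl⟩; exact h e he⟩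

theorem edgeSetoid_rel (r : E × Bool → F) {S : Finset E} {e : E} (h : e ∈ S) :
    edgeSetoid r S (r (e, true)) (r (e, false)) := edgeSetoid_le.1 le_rfl e h

theorem edgeSetoid_rel_flip (r : E × Bool → F) {S : Finset E} {x : E × Bool} (h : x.1 ∈ S) :
    edgeSetoid r S (r x) (r (x.1, !x.2)) := by
  obtain ⟨e, b⟩ := x
  cases b
  · exact Setoid.symm' _ (edgeSetoid_rel r h)
  · exact edgeSetoid_rel r h

@[simp]
theorem edgeSetoid_empty (r : E × Bool → F) : edgeSetoid r ∅ = ⊥ :=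
  le_bot_iff.1 (edgeSetoid_le.2 (by simp))

theorem edgeSetoid_mono (r : E × Bool → F) {S T : Finset E} (h : S ⊆ T) :
    edgeSetoid r S ≤ edgeSetoid r T :=
  edgeSetoid_le.2 fun _ he => edgeSetoid_rel r (h he)

theorem edgeSetoid_insert (r : E × Bool → F) (e : E) (S : Finset E) :
    edgeSetoid r (insert e S) = edgeSetoid r S ⊔ pair (r (e, true)) (r (e, false)) := by
  refine le_antisymm (edgeSetoid_le.2 fun f hf => ?_) (sup_le
    (edgeSetoid_mono r (Finset.subset_insert e S))
    (pair_le.2 (edgeSetoid_rel r (Finset.mem_insert_self e S))))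
  rcases Finset.mem_insert.1 hf with rfl | hf
  · exact (le_sup_right : pair _ _ ≤ _) (pair_rel _ _)
  · exact (le_sup_left : edgeSetoid r S ≤ _) (edgeSetoid_rel r hf)

theorem orb_flipOn_mul_le {π : Perm (E × Bool)} {K : Setoid F} {r : E × Bool → F}
    (h : orb π ≤ comap r K) (S : Finset E) :
    orb (flipOn S * π) ≤ comap r (K ⊔ edgeSetoid r S) := by
  refine orb_le.2 fun x => ?_
  have h1 := (le_sup_left : K ≤ K ⊔ edgeSetoid r S) (h (orb_rel π x))
  by_cases hx : (π x).1 ∈ S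
  · rw [Perm.mul_apply, flipOn_of_mem hx]
    exact Setoid.trans' _ h1
      ((le_sup_right : edgeSetoid r S ≤ K ⊔ edgeSetoid r S) (edgeSetoid_rel_flip r hx))
  · rw [Perm.mul_apply, flipOn_of_notMem hx]
    exact h1

variable [Finite E]

theorem euler_edges_disjoint [Finite F] {π : Perm (E × Bool)} {K : Setoid F} {r : E × Bool → F}
    (h : orb π ≤ comap r K) (S U : Finset E) (hd : Disjoint S U) :
    2 * (K ⊔ edgeSetoid r S).numClasses + (orb (flipOn (S ∪ U) * π)).numClasses ≤
      2 * (K ⊔ edgeSetoid r (S ∪ U)).numClasses + (orb (flipOn S * π)).numClasses + U.card := by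
  induction U using Finset.induction_on with
  | empty => simp
  | insert e U he ih =>
    have hd' := Finset.disjoint_insert_right.1 hd
    have heS : e ∉ S ∪ U := by simp [he, hd'.1]
    have ih := ih hd'.2
    have hstep := euler_step (flipOn (S ∪ U) * π) (orb_flipOn_mul_le h (S ∪ U))
      (show (e, true) ≠ (e, false) by simp)
    rw [Finset.union_insert, flipOn_insert heS, edgeSetoid_insert, Finset.card_insert_of_notMem he,
      mul_assoc, ← sup_assoc]
    omega

/-- The iterated `euler_step`. With vertex orbits as classes it bounds the genus of a subgraph; with
`π` the boundary permutation and regions as points it gives the corresponding bound for the dual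
graph. -/
theorem euler_edges [Finite F] {π : Perm (E × Bool)} {K : Setoid F} {r : E × Bool → F}
    (h : orb π ≤ comap r K) {S T : Finset E} (hST : S ⊆ T) :
    2 * (K ⊔ edgeSetoid r S).numClasses + (orb (flipOn T * π)).numClasses + S.card ≤
      2 * (K ⊔ edgeSetoid r T).numClasses + (orb (flipOn S * π)).numClasses + T.card := by
  have h1 := euler_edges_disjoint h S (T \ S) Finset.disjoint_sdiff
  rw [Finset.union_sdiff_of_subset hST, Finset.card_sdiff_of_subset hST] at h1
  have := Finset.card_le_card hST
  omega

/-- The partition of the darts according to the components of the graph with edge set `S`. -/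
def conn (ρ : Perm (E × Bool)) (S : Finset E) : Setoid (E × Bool) := orb ρ ⊔ edgeSetoid id S

/-- The right side minus the left side is twice the total genus. -/
theorem euler_le (ρ : Perm (E × Bool)) (S : Finset E) :
    (orb ρ).numClasses + (orb (flipOn S * ρ)).numClasses ≤
      2 * (conn ρ S).numClasses + S.card := by
  have := euler_edges (π := ρ) (K := orb ρ) (r := id) le_rfl S.empty_subset
  simp only [edgeSetoid_empty, sup_bot_eq, flipOn_empty, one_mul, Finset.card_empty] at this
  rw [conn]
  omega

/-- The ribbon graph with the cyclic orders `ρ` and the edges in `S` has genus zero. -/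
def IsPlanar (ρ : Perm (E × Bool)) (S : Finset E) : Prop :=
  (orb ρ).numClasses + (orb (flipOn S * ρ)).numClasses = 2 * (conn ρ S).numClasses + S.card

/-- The defect `2 · components + edges - vertices - faces` cannot decrease when edges are added, and
it is never negative. -/
theorem IsPlanar.mono {ρ : Perm (E × Bool)} {S T : Finset E} (h : IsPlanar ρ T) (hST : S ⊆ T) :
    IsPlanar ρ S := by
  have h1 := euler_edges (π := ρ) (K := orb ρ) (r := id) le_rfl hST
  have h2 := euler_le ρ S
  simp only [IsPlanar, conn] at *
  omega

/-- Splitting a vertex preserves planarity. -/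
theorem IsPlanar.mul_swap {ρ : Perm (E × Bool)} {S : Finset E} (h : IsPlanar ρ S)
    {a b : E × Bool} (hab : a ≠ b) (ho : orb ρ a b) : IsPlanar (ρ * swap a b) S := by
  have h1 := numClasses_orb_mul_swap_of_orb hab ho
  have h2 := euler_step_right (flipOn S * (ρ * swap a b)) (K := conn (ρ * swap a b) S) (r := id)
    (orb_flipOn_mul_le (K := orb (ρ * swap a b)) (r := id) le_rfl S) hab
  have h3 : conn (ρ * swap a b) S ⊔ pair (id a) (id b) = conn ρ S := by
    rw [conn, conn, sup_right_comm, id, id, orb_mul_swap_sup_pair, sup_pair_of_rel ho]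
  rw [h3, mul_assoc, mul_assoc, swap_mul_self, mul_one] at h2
  have h4 := euler_le (ρ * swap a b) S
  simp only [IsPlanar] at *
  omega

/-- The two sides of a loop are different in the plane. -/
theorem IsPlanar.not_orb_of_loop {ρ : Perm (E × Bool)} {S : Finset E} {e : E} (heS : e ∉ S)
    (h : IsPlanar ρ (insert e S)) (ho : orb ρ (e, true) (e, false)) :
    ¬ orb (flipOn (insert e S) * ρ) (e, true) (e, false) := by
  intro h1
  have h2 := numClasses_orb_swap_mul_of_orb (show (e, true) ≠ (e, false) by simp) h1
  rw [flipOn_insert heS, mul_assoc, swap_mul_self_mul] at h2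
  have h3 := h.mono (Finset.subset_insert e S)
  -- A loop leaves the components unchanged, so planarity with and without `e` makes the number of
  -- faces rise by one when `e` is added. Equal sides would make it fall by one.
  have h4 : conn ρ (insert e S) = conn ρ S := by
    rw [conn, edgeSetoid_insert, ← sup_assoc]
    exact sup_pair_of_rel ((le_sup_left : orb ρ ≤ _) ho)
  rw [IsPlanar, h4, Finset.card_insert_of_notMem heS, flipOn_insert heS, mul_assoc] at h
  rw [IsPlanar] at h3
  omega

/-- If the orbits of two darts of a vertex other than that of the loop `e` lie on the two sides of
`e`, then the ribbon graph is not planar. -/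
theorem IsPlanar.not_orb_orb {ρ : Perm (E × Bool)} {S : Finset E} {e : E} (heS : e ∉ S)
    (h : IsPlanar ρ (insert e S)) (ho : orb ρ (e, true) (e, false)) {a b : E × Bool}
    (hab : orb ρ a b) (hea : ¬ orb ρ a (e, true))
    (h1 : orb (flipOn (insert e S) * ρ) (e, true) a) :
    ¬ orb (flipOn (insert e S) * ρ) (e, false) b := by
  intro h2
  have h0 := h.not_orb_of_loop heS ho
  have hab' : ¬ orb (flipOn (insert e S) * ρ) a b := fun h3 =>
    h0 (Setoid.trans' _ h1 (Setoid.trans' _ h3 (Setoid.symm' _ h2)))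
  have hne : a ≠ b := fun h3 => hab' (h3 ▸ Setoid.refl' _ _)
  -- Split the vertex of `a` and `b`. The ribbon graph stays planar and `e` stays a loop, but the
  -- faces of `a` and `b` merge, and with them the two sides of `e`.
  have hp := h.mul_swap hne hab
  have ho' : orb (ρ * swap a b) (e, true) (e, false) := by
    -- The split affects only the orbit of `a`; on all other darts this relation is that of the new
    -- orbits.
    let s : Setoid (E × Bool) :=
      { r := fun x y => (orb ρ x a ↔ orb ρ y a) ∧ (¬ orb ρ x a → orb (ρ * swap a b) x y)
        iseqv :=
          { refl := fun x => ⟨Iff.rfl, fun _ => Setoid.refl' _ _⟩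
            symm := fun h => ⟨h.1.symm, fun h' =>
              Setoid.symm' _ (h.2 (mt h.1.1 h'))⟩
            trans := fun h h' => ⟨h.1.trans h'.1, fun h'' =>
              Setoid.trans' _ (h.2 h'') (h'.2 (mt h.1.2 h''))⟩ } }
    have hs : orb ρ ≤ s := by
      refine orb_le.2 fun x => ⟨⟨fun hx => Setoid.trans' _ (Setoid.symm' _ (orb_rel ρ x)) hx,
        fun hx => Setoid.trans' _ (orb_rel ρ x) hx⟩, fun hx => ?_⟩
      have hxa : x ≠ a := fun h => hx (h ▸ Setoid.refl' _ _)
      have hxb : x ≠ b := fun h => hx (h ▸ Setoid.symm' _ hab)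
      have := orb_rel (ρ * swap a b) x
      rwa [Perm.mul_apply, swap_apply_of_ne_of_ne hxa hxb] at this
    exact (hs ho).2 fun h => hea (Setoid.symm' _ h)
  refine hp.not_orb_of_loop heS ho' ?_
  have hm := orb_mul_swap_of_not_orb hab'
  have hle : orb (flipOn (insert e S) * ρ) ≤ orb (flipOn (insert e S) * ρ * swap a b) := by
    have h4 := orb_mul_swap_sup_pair (flipOn (insert e S) * ρ) a b
    rw [sup_pair_of_rel hm] at h4
    rw [h4]
    exact le_sup_left
  rw [← mul_assoc]
  exact Setoid.trans' _ (hle h1) (Setoid.trans' _ hm (Setoid.symm' _ (hle h2)))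

end Ribbon

/-! ### Interrupted flows -/

namespace Setoid

open Equiv

variable {D D' ι : Type*}

theorem comap_sup_pair {s : Setoid D} {f : ι → D} {a : D} (b : D) (h : ∀ i, ¬ s (f i) a) :
    comap f (s ⊔ pair a b) = comap f s := by
  classical
  ext i j
  rw [sup_pair_eq_ker, comap_rel, comap_rel, ker_def, if_neg (h i), if_neg (h j), Quotient.eq]

theorem comap_eq_of_rel {s : Setoid D} {f g : ι → D} (h : ∀ i, s (f i) (g i)) :
    comap f s = comap g s := by
  ext i j
  exact ⟨fun h' => s.trans (s.symm (h i)) (s.trans h' (h j)),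
    fun h' => s.trans (h i) (s.trans h' (s.symm (h j)))⟩

theorem flow_swap_mul_sup_pair [DecidableEq D] (π : Perm D) (O : Set D) (a b : D) :
    flow (swap a b * π) O ⊔ pair a b = flow π O ⊔ pair a b := by
  have key : ∀ (π : Perm D), flow (swap a b * π) O ≤ flow π O ⊔ pair a b := by
    intro π
    refine flow_le.2 fun x hO => ?_
    have hp := (le_sup_right : pair a b ≤ flow π O ⊔ pair a b) (pair_rel a b)
    have hx := (le_sup_left : flow π O ≤ flow π O ⊔ pair a b) (flow_rel hO)
    refine Setoid.trans' _ hx ?_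
    rw [Perm.mul_apply]
    rcases eq_or_ne (π x) a with h | h
    · rw [h, swap_apply_left]; exact hp
    · rcases eq_or_ne (π x) b with h' | h'
      · rw [h', swap_apply_right]; exact Setoid.symm' _ hp
      · rw [swap_apply_of_ne_of_ne h h']
  refine le_antisymm (sup_le (key π) le_sup_right) (sup_le ?_ le_sup_right)
  have := key (swap a b * π)
  rwa [swap_mul_self_mul] at this

/-- The walk of `orb_swap_mul_of_not_orb`; as no interruption lies on the orbit of `a`, the flow
follows it all the way round. -/
theorem flow_swap_mul_rel [Finite D] [DecidableEq D] {π : Perm D} {O : Set D} {a b : D}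
    (h : ¬ orb π a b) (hO : ∀ x ∈ O, ¬ orb π a x) : flow (swap a b * π) O a b := by
  classical
  have hex := exists_iterate_eq_self π a
  let m := Nat.find hex
  have hm : π^[m + 1] a = a := Nat.find_spec hex
  have hlt : ∀ i < m, π^[i + 1] a ≠ a := fun i hi => Nat.find_min hex hi
  have hne : ∀ i, π^[i] a ≠ b := fun i hi => h (hi ▸ orb_iterate π a i)
  have hOi : ∀ i, π^[i] a ∉ O := fun i hi => hO _ hi (orb_iterate π a i)
  have step : ∀ i ≤ m, flow (swap a b * π) O a (π^[i] a) := by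
    intro i
    induction i with
    | zero => intro _; exact Setoid.refl' _ _
    | succ i ih =>
      intro hi
      have h1 := flow_rel (f := swap a b * π) (hOi i)
      rw [Perm.mul_apply, ← Function.iterate_succ_apply' π,
        swap_apply_of_ne_of_ne (hlt i (by omega)) (hne _)] at h1
      exact Setoid.trans' _ (ih (by omega)) h1
  have h1 := flow_rel (f := swap a b * π) (hOi m)
  rw [Perm.mul_apply, ← Function.iterate_succ_apply' π, hm, swap_apply_left] at h1
  exact Setoid.trans' _ (step m le_rfl) h1

/-- Merging a closed orbit with another orbit. -/
theorem flow_merge [Finite D] [DecidableEq D] {π : Perm D} {O : Set D} {a b : D}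
    (h : ¬ orb π a b) (hO : ∀ x ∈ O, ¬ orb π a x) {f g : ι → D}
    (hf : ∀ i, ∃ x ∈ O, orb π (f i) x) (hfg : ∀ i, g i = f i ∨ g i = swap a b (f i)) :
    comap g (flow (swap a b * π) O) = comap f (flow π O) ∧
      (flow π O).numClasses = (flow (swap a b * π) O).numClasses + 1 := by
  have h1 := flow_swap_mul_rel h hO
  have h2 : flow (swap a b * π) O = flow π O ⊔ pair a b := by
    rw [← flow_swap_mul_sup_pair, sup_pair_of_rel h1]
  refine ⟨?_, ?_⟩
  -- The orbit of `a` is closed and contains no `f i`, so the merger does not change how these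
  -- points are connected.
  · rw [comap_eq_of_rel (g := f), h2, comap_sup_pair]
    · intro i hi
      obtain ⟨x, hx, hix⟩ := hf i
      exact hO x hx (Setoid.trans' _ (Setoid.symm' _ (flow_le_orb π O hi)) hix)
    · intro i
      rcases hfg i with h3 | h3
      · rw [h3]
      · rw [h3]
        rcases eq_or_ne (f i) a with h | h
        · rw [h, swap_apply_left]; exact Setoid.symm' _ h1
        · rcases eq_or_ne (f i) b with h' | h'
          · rw [h', swap_apply_right]; exact h1
          · rw [swap_apply_of_ne_of_ne h h']
  · rw [h2]
    exact numClasses_eq_sup_pair_add_one fun h' => h (flow_le_orb π O h')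

open Classical in
/-- Removing a point which does not interrupt the flow. -/
theorem flow_remove [Finite D] {π : D → D} {O : Set D} {x : D} (hx : x ∉ O)
    {j : D' → D} (hj : j.Injective) (hrange : ∀ z, (∃ w, j w = z) ↔ z ≠ x) {π' : D' → D'}
    (hπ' : ∀ w, j (π' w) = if π (j w) = x then π x else π (j w)) :
    comap j (flow π O) = flow π' (j ⁻¹' O) ∧
      (flow π O).numClasses = (flow π' (j ⁻¹' O)).numClasses + if π x = x then 1 else 0 := by
  have hjx : ∀ w, j w ≠ x := fun w => (hrange _).1 ⟨w, rfl⟩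
  let s' := flow π' (j ⁻¹' O)
  -- The removed point is sent to the class of its successor, or to `none` if it is a fixed point
  -- and thus a class that disappears.
  let g : D → Option (Quotient s') := fun z =>
    if h : z = x then (if h' : π x = x then none else
      some (Quotient.mk _ ((hrange (π x)).2 h').choose)) else
      some (Quotient.mk _ ((hrange z).2 h).choose)
  have hgj : ∀ w, g (j w) = some (Quotient.mk _ w) := by
    intro w
    simp only [g, dif_neg (hjx w)]
    congr 2
    exact hj ((hrange (j w)).2 (hjx w)).choose_spec
  have hgx : ∀ w, π x = j w → g x = some (Quotient.mk _ w) := by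
    intro w hw
    have h' : π x ≠ x := by rw [hw]; exact hjx w
    simp only [g, dif_pos, dif_neg h']
    congr 2
    exact hj (((hrange _).2 h').choose_spec.trans hw)
  have hle : flow π O ≤ ker g := by
    refine flow_le.2 fun z hz => ?_
    rw [ker_def]
    by_cases hzx : z = x
    · subst hzx
      by_cases h' : π z = z
      · rw [h']
      · obtain ⟨w, hw⟩ := (hrange _).2 h'
        rw [hgx w hw.symm, ← hw, hgj]
    · obtain ⟨w, rfl⟩ := (hrange _).2 hzx
      have hrel : s' w (π' w) := flow_rel (f := π') (O := j ⁻¹' O) hz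
      have hq : (Quotient.mk s' w) = Quotient.mk s' (π' w) := Quotient.sound hrel
      rw [hgj, hq]
      have hw := hπ' w
      by_cases h1 : π (j w) = x
      · rw [if_pos h1] at hw
        rw [h1, hgx _ hw.symm]
      · rw [if_neg h1] at hw
        rw [← hw, hgj]
  have hcomap : comap j (flow π O) = flow π' (j ⁻¹' O) := by
    refine le_antisymm (fun u v huv => ?_) (flow_le.2 fun w hw => ?_)
    · have := hle huv
      rw [ker_def, hgj, hgj] at this
      exact Quotient.exact (Option.some_injective _ this)
    · rw [comap_rel, hπ']
      have h1 := flow_rel (f := π) (show j w ∉ O from hw)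
      split_ifs with h2
      · rw [h2] at h1
        exact Setoid.trans' _ h1 (flow_rel hx)
      · exact h1
  refine ⟨hcomap, ?_⟩
  rw [← freeClasses_add_numClasses_comap (flow π O) j, hcomap, add_comm]
  congr 1
  rw [freeClasses]
  split_ifs with h1
  · rw [Nat.card_eq_one_iff_unique]
    have hx' : ∀ w, ¬ flow π O (j w) x := by
      intro w hw
      have := hle hw
      rw [ker_def, hgj] at this
      simp [g, h1] at this
    refine ⟨⟨fun c c' => ?_⟩, ⟨⟨Quotient.mk _ x, fun w hw => hx' w (Quotient.exact hw)⟩⟩⟩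
    have key : ∀ c : {c : Quotient (flow π O) // ∀ i, Quotient.mk _ (j i) ≠ c},
        c.1 = Quotient.mk _ x := by
      rintro ⟨c, hc⟩
      induction c using Quotient.ind with
      | _ z =>
        by_contra hzx
        obtain ⟨w, rfl⟩ := (hrange z).2 fun h => hzx (h ▸ rfl)
        exact hc w rfl
    exact Subtype.ext ((key c).trans (key c').symm)
  · rw [Nat.card_eq_zero]
    left
    refine ⟨?_⟩
    rintro ⟨c, hc⟩
    induction c using Quotient.ind with
    | _ z =>
      by_cases hzx : z = x
      · subst hzx
        obtain ⟨w, hw⟩ := (hrange _).2 h1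
        refine hc w (Quotient.sound ?_)
        rw [hw]
        exact Setoid.symm' _ (flow_rel hx)
      · obtain ⟨w, rfl⟩ := (hrange _).2 hzx
        exact hc w rfl

open Classical in
/-- The number of orbits of an injective map `π` which are contained in `{x, y}`. -/
def localOrbits (π : D → D) (x y : D) : ℕ :=
  (if π x = x then 1 else 0) + if (if π y = x then π x else π y) = y then 1 else 0

theorem localOrbits_congr {π π' : D → D} {x y : D} (hxx : π x = x ↔ π' x = x)
    (hxy : π x = y ↔ π' x = y) (hyx : π y = x ↔ π' y = x) (hyy : π y = y ↔ π' y = y) :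
    localOrbits π x y = localOrbits π' x y := by
  classical
  unfold localOrbits
  by_cases h : π y = x
  · rw [if_pos h, if_pos (hyx.1 h)]
    exact congrArg₂ _ (if_congr hxx rfl rfl) (if_congr hxy rfl rfl)
  · rw [if_neg h, if_neg (mt hyx.2 h)]
    exact congrArg₂ _ (if_congr hxx rfl rfl) (if_congr hyy rfl rfl)

open Classical in
/-- Removing two points which do not interrupt the flow. -/
theorem flow_remove_two [Finite D] {π : D → D} (hπ : π.Injective) {O : Set D} {x y : D}
    (hxy : x ≠ y) (hx : x ∉ O) (hy : y ∉ O) {j : D' → D} (hj : j.Injective)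
    (hrange : ∀ z, (∃ w, j w = z) ↔ z ≠ x ∧ z ≠ y) {π' : D' → D'} {hop : D → D}
    (hhop : ∀ z, hop z = if z = x ∨ z = y then π z else z)
    (hπ' : ∀ w, j (π' w) = hop (hop (π (j w)))) :
    comap j (flow π O) = flow π' (j ⁻¹' O) ∧
      (flow π O).numClasses = (flow π' (j ⁻¹' O)).numClasses + localOrbits π x y := by
  -- Remove `x` first, then remove `y` from the induced map `p`.
  let M := {z : D // z ≠ x}
  let i : M → D := Subtype.val
  have hi : i.Injective := Subtype.val_injective
  have hmid : ∀ z : M, (if π z = x then π x else π z) ≠ x := by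
    intro z
    split_ifs with h
    · exact fun h' => z.2 (hπ (h.trans h'.symm))
    · exact h
  let p : M → M := fun z => ⟨_, hmid z⟩
  have hp : ∀ z : M, i (p z) = if π (i z) = x then π x else π (i z) := fun _ => rfl
  have hpinj : p.Injective := by
    intro z w hzw
    have h := congrArg i hzw
    rw [hp, hp] at h
    have hzx := z.2
    have hwx := w.2
    refine hi ?_
    split_ifs at h with h1 h2 h2
    · exact hπ (h1.trans h2.symm)
    · exact absurd (hπ h).symm hwx
    · exact absurd (hπ h) hzx
    · exact hπ h
  have h1 := flow_remove hx hi (fun z => ⟨by rintro ⟨w, rfl⟩; exact w.2,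
    fun h => ⟨⟨z, h⟩, rfl⟩⟩) hp
  have hjx : ∀ w, j w ≠ x ∧ j w ≠ y := fun w => (hrange _).1 ⟨w, rfl⟩
  let k : D' → M := fun w => ⟨j w, (hjx w).1⟩
  have hik : ∀ w, i (k w) = j w := fun _ => rfl
  let y' : M := ⟨y, hxy.symm⟩
  -- Two hops are enough: starting outside `{x, y}`, an injective map visits each of these points at
  -- most once before leaving.
  have hk : ∀ w, k (π' w) = if p (k w) = y' then p y' else p (k w) := by
    intro w
    refine hi ?_
    have e1 : p (k w) = y' ↔ i (p (k w)) = y := ⟨fun h => congrArg i h, fun h => hi h⟩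
    rw [apply_ite i, hik, hπ', hp]
    simp only [e1, hp, hik]
    have hr := hjx (π' w)
    rw [hπ'] at hr
    have hinj1 : π (j w) ≠ π x := hπ.ne (hjx w).1
    have hinj2 : π (j w) ≠ π y := hπ.ne (hjx w).2
    have hiy : i y' = y := rfl
    rw [hiy]
    simp only [hhop] at hr ⊢
    split_ifs at hr ⊢ <;> simp_all
  have h2 := flow_remove (O := i ⁻¹' O) (x := y') hy (j := k)
    (fun u v h => hj (congrArg i h)) (fun z => ⟨by
      rintro ⟨w, rfl⟩ h
      exact (hjx w).2 (congrArg i h), fun h => by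
      obtain ⟨w, hw⟩ := (hrange z.1).2 ⟨z.2, fun h' => h (hi h')⟩
      exact ⟨w, hi hw⟩⟩) (fun w => by rw [hk w]; congr)
  refine ⟨?_, ?_⟩
  · change comap k (comap i (flow π O)) = _
    rw [h1.1, h2.1]
    rfl
  · rw [h1.2, h2.2, localOrbits]
    have e1 : p y' = y' ↔ (if π y = x then π x else π y) = y :=
      ⟨fun h => congrArg i h, fun h => hi h⟩
    simp only [e1]
    have e2 : k ⁻¹' (i ⁻¹' O) = j ⁻¹' O := rfl
    rw [e2]
    omega

/-- Along a flow, there is at most one interruption. -/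
theorem eq_of_flow {π : D → D} {O : Set D} {x y : D} (hx : x ∈ O) (hy : y ∈ O)
    (h : flow π O x y) : x = y := by
  -- The first interruption met by forward iteration is constant along the flow.
  have hle : flow π O ≤ ker fun z => ∃ k, π^[k] z = x ∧ ∀ i < k, π^[i] z ∉ O := by
    refine flow_le.2 fun z hz => propext ⟨?_, ?_⟩
    · rintro ⟨k, hk, hk'⟩
      obtain _ | k := k
      · exact absurd (show z ∈ O from (show z = x from hk) ▸ hx) hz
      · exact ⟨k, hk, fun i hi => hk' (i + 1) (by omega)⟩
    · rintro ⟨k, hk, hk'⟩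
      refine ⟨k + 1, hk, fun i hi => ?_⟩
      obtain _ | i := i
      · exact hz
      · exact hk' i (by omega)
  obtain ⟨k, hk, hk'⟩ := (iff_of_eq (hle h)).1 ⟨0, rfl, by simp⟩
  obtain _ | k := k
  · exact hk.symm
  · exact absurd hy (hk' 0 (by omega))

/-- Along a flow, there is at most one starting point. -/
theorem eq_of_flow_apply {π : D → D} (hπ : π.Injective) {O : Set D} {x y : D} (hx : x ∈ O)
    (hy : y ∈ O) (h : flow π O (π x) (π y)) : x = y := by
  -- Lying on the uninterrupted stretch that begins at `π x` is constant along the flow.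
  have hle : flow π O ≤ ker fun z => ∃ k, π^[k] (π x) = z ∧ ∀ i < k, π^[i] (π x) ∉ O := by
    refine flow_le.2 fun z hz => propext ⟨?_, ?_⟩
    · rintro ⟨k, hk, hk'⟩
      refine ⟨k + 1, by rw [Function.iterate_succ_apply', hk], fun i hi => ?_⟩
      rcases Nat.lt_or_ge i k with h | h
      · exact hk' i h
      · rw [show i = k by omega, hk]; exact hz
    · rintro ⟨k, hk, hk'⟩
      obtain _ | k := k
      · exact absurd (hπ (show π x = π z from hk) ▸ hx) hz
      · rw [Function.iterate_succ_apply'] at hk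
        exact ⟨k, hπ hk, fun i hi => hk' i (by omega)⟩
  obtain ⟨k, hk, hk'⟩ := (iff_of_eq (hle h)).1 ⟨0, rfl, by simp⟩
  obtain _ | k := k
  · exact hπ hk
  · rw [Function.iterate_succ_apply'] at hk
    exact absurd hy (hπ hk ▸ hk' k (by omega))

theorem exists_flow_apply [Finite D] (π : Perm D) {O : Set D} {x : D} (hx : x ∈ O) :
    ∃ y ∈ O, flow π O (π x) y := by
  classical
  have hex : ∃ k, π^[k] (π x) ∈ O := by
    obtain ⟨k, hk⟩ := exists_iterate_eq_self π x
    exact ⟨k, by rw [← Function.iterate_succ_apply, hk]; exact hx⟩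
  exact ⟨_, Nat.find_spec hex, flow_iterate fun i hi => Nat.find_min hex hi⟩

/-- Passing from each interruption to the next is injective by `eq_of_flow_apply`, hence surjective
on a finite set. -/
theorem exists_apply_flow [Finite D] (π : Perm D) {O : Set D} {y : D} (hy : y ∈ O) :
    ∃ x ∈ O, flow π O (π x) y := by
  choose f hf hf' using fun x : O => exists_flow_apply π x.2
  have hinj : Function.Injective fun x : O => (⟨f x, hf x⟩ : O) := by
    intro u v huv
    have huv : f u = f v := congrArg Subtype.val huv
    refine Subtype.ext (eq_of_flow_apply π.injective u.2 v.2 ?_)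
    refine Setoid.trans' _ (hf' u) ?_
    rw [huv]
    exact Setoid.symm' _ (hf' v)
  obtain ⟨x, hx⟩ := Finite.surjective_of_injective hinj ⟨y, hy⟩
  have hx : f x = y := congrArg Subtype.val hx
  exact ⟨x, x.2, hx ▸ hf' x⟩

theorem flow_congr {π π' : D → D} {O : Set D} (h : ∀ x ∉ O, π x = π' x) :
    flow π O = flow π' O :=
  le_antisymm (flow_le.2 fun x hx => h x hx ▸ flow_rel hx)
    (flow_le.2 fun x hx => (h x hx).symm ▸ flow_rel hx)

end Setoid

/-! ### Drawings on the sphere have genus zero -/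

namespace Drawing.IsSpherical

open Equiv Setoid Ribbon
open scoped Classical

variable {M : Drawing}

theorem _root_.Setoid.numClasses_bot {α : Type*} : (⊥ : Setoid α).numClasses = Nat.card α :=
  (Nat.card_congr (Equiv.ofBijective (Quotient.mk ⊥)
    ⟨fun _ _ h => Quotient.exact h, Quotient.mk_surjective⟩)).symm

/-- Dart orbits see only the vertices of positive valency; each isolated vertex is a class of its
own and is added separately. -/
theorem _root_.Drawing.numClasses_vertices (K : Setoid M.V)
    (hK : ∀ v w, M.IsIsolated v → K v w → v = w) :
    K.numClasses = (comap M.vert K).numClasses + Nat.card {v // M.IsIsolated v} := by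
  rw [← freeClasses_add_numClasses_comap K M.vert, add_comm, freeClasses]
  congr 1
  let f : {v // M.IsIsolated v} → {c : Quotient K // ∀ x, Quotient.mk K (M.vert x) ≠ c} :=
    fun v => ⟨Quotient.mk K v.1, fun x hx =>
      v.2 x (hK v.1 _ v.2 (K.symm (Quotient.exact hx))).symm⟩
  refine Nat.card_congr (Equiv.ofBijective f ⟨fun v w hvw => ?_, ?_⟩).symm
  · exact Subtype.ext (hK _ _ v.2 (Quotient.exact (congrArg Subtype.val hvw)))
  · rintro ⟨c, hc⟩
    induction c using Quotient.ind with
    | _ v => exact ⟨⟨v, fun x hx => hc x (hx ▸ rfl)⟩, rfl⟩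

theorem orb_rot_iff (h : M.IsSpherical) (x y : M.Dart) : orb M.rot x y ↔ M.vert x = M.vert y := by
  refine ⟨fun hxy => ?_, fun hxy => ?_⟩
  · have hle : orb M.rot ≤ ker M.vert := orb_le.2 fun z => (h.vert_rot z).symm
    exact hle hxy
  · obtain ⟨k, hk⟩ := (h.sameCycle_of_vert_eq x y hxy).exists_pow_eq'
    rw [← hk.2, Perm.coe_pow]
    exact orb_iterate _ _ _

theorem comap_vert_bot (h : M.IsSpherical) : comap M.vert ⊥ = orb M.rot := by
  ext x y
  exact (h.orb_rot_iff x y).symm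

theorem card_vertices (h : M.IsSpherical) :
    Fintype.card M.V = (orb M.rot).numClasses + Nat.card {v // M.IsIsolated v} := by
  rw [← h.comap_vert_bot, ← numClasses_vertices ⊥ fun v w _ h => h, numClasses_bot,
    ← Nat.card_eq_fintype_card]

theorem graphComponents_eq (h : M.IsSpherical) :
    M.graphComponents = (conn M.rot Finset.univ).numClasses +
      Nat.card {v // M.IsIsolated v} := by
  rw [graphComponents, card_quot]
  set K : Setoid M.V := gen fun a b => ∃ x, M.vert x = a ∧ M.vert (flip x) = b with hKdef
  have hK : ∀ v w, M.IsIsolated v → K v w → v = w := by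
    have hle : K ≤ ker fun v => if M.IsIsolated v then some v else none := by
      refine gen_le.2 ?_
      rintro _ _ ⟨x, rfl, rfl⟩
      rw [ker_def, if_neg fun h => h x rfl, if_neg fun h => h _ rfl]
    intro v w hv hvw
    have h1 := hle hvw
    rw [ker_def, if_pos hv] at h1
    split_ifs at h1
    exact Option.some_injective _ h1
  rw [numClasses_vertices K hK]
  congr 2
  refine le_antisymm (fun x y hxy => ?_) (sup_le (orb_le.2 fun x => ?_)
    (edgeSetoid_le.2 fun e _ => gen_rel ⟨(e, true), rfl, rfl⟩))
  · let C := conn M.rot Finset.univ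
    let g : M.V → Option (Quotient C) := fun v =>
      if h : ∃ x, M.vert x = v then some (Quotient.mk C h.choose) else none
    have hg : ∀ x, g (M.vert x) = some (Quotient.mk C x) := by
      intro x
      have h' : ∃ y, M.vert y = M.vert x := ⟨x, rfl⟩
      simp only [g, dif_pos h']
      refine congrArg some (Quotient.sound ?_)
      exact (le_sup_left : orb M.rot ≤ C) ((h.orb_rot_iff _ _).2 h'.choose_spec)
    have hle : K ≤ ker g := by
      refine gen_le.2 ?_
      rintro _ _ ⟨x, rfl, rfl⟩
      rw [ker_def, hg, hg]
      refine congrArg some (Quotient.sound ?_)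
      exact (le_sup_right : edgeSetoid id (Finset.univ : Finset M.E) ≤ C)
        (edgeSetoid_rel_flip id (Finset.mem_univ x.1))
    have h1 := hle hxy
    rw [ker_def, hg, hg] at h1
    exact Quotient.exact (Option.some_injective _ h1)
  · rw [comap_rel, h.vert_rot]

theorem orb_flipOn_univ_le (h : M.IsSpherical) :
    orb (flipOn (Finset.univ : Finset M.E) * M.rot) ≤ comap M.region ⊥ := by
  refine orb_le.2 fun x => ?_
  rw [Perm.mul_apply, flipOn_of_mem (Finset.mem_univ _)]
  exact (h.region_corner x).symm

/-- The dual graph is connected. Regions at a common vertex are linked by crossing the edges there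
one after another, and incidences of vertices with regions connect everything. -/
theorem edgeSetoid_region_univ (h : M.IsSpherical) (f g : M.F) :
    edgeSetoid M.region Finset.univ f g := by
  let K := edgeSetoid M.region Finset.univ
  have h1 : ∀ x y, M.vert x = M.vert y → K (M.region x) (M.region y) := by
    have hle : orb M.rot ≤ comap M.region K := by
      refine orb_le.2 fun x => ?_
      have h2 : K (M.region (M.rot x)) (M.region (flip (M.rot x))) :=
        edgeSetoid_rel_flip M.region (Finset.mem_univ _)
      rw [h.region_corner] at h2
      exact K.symm h2
    intro x y hxy
    exact hle ((h.orb_rot_iff x y).2 hxy)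
  have h2 : ∀ v f g, M.Touches v f → M.Touches v g → K f g := by
    rintro v f g (⟨x, rfl, rfl⟩ | ⟨hv, rfl⟩) (⟨y, hy, rfl⟩ | ⟨hv', rfl⟩)
    · exact h1 _ _ hy.symm
    · exact absurd rfl (hv' x)
    · exact absurd hy (hv y)
    · exact K.refl _
  -- The set of regions linked to a vertex or to a region is constant along incidences.
  let c : M.V ⊕ M.F → Set M.F := Sum.elim (fun v => {f | ∃ g, M.Touches v g ∧ K g f})
    (fun g => {f | K g f})
  have hc : ∀ a b, Relation.EqvGen (fun a b => ∃ v f, M.Touches v f ∧ a = Sum.inl v ∧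
      b = Sum.inr f) a b → c a = c b := by
    intro a b hab
    induction hab with
    | rel a b hab =>
      obtain ⟨v, f, hvf, rfl, rfl⟩ := hab
      ext g
      exact ⟨fun ⟨k, hk, hkg⟩ => K.trans (h2 v f k hvf hk) hkg, fun hg => ⟨f, hvf, hg⟩⟩
    | refl => rfl
    | symm _ _ _ ih => exact ih.symm
    | trans _ _ _ _ _ ih ih' => exact ih.trans ih'
  have h3 : g ∈ c (Sum.inr g) := K.refl g
  rw [← hc _ _ (h.connected (Sum.inr f) (Sum.inr g))] at h3
  exact h3

theorem _root_.Drawing.nonempty_region (M : Drawing) [Nonempty M.V] : Nonempty M.F := by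
  obtain ⟨v⟩ := ‹Nonempty M.V›
  by_cases hv : M.IsIsolated v
  · exact ⟨M.isoRegion v hv⟩
  · simp only [IsIsolated, not_forall, not_not] at hv
    exact ⟨M.region hv.choose⟩

/-- Euler's inequalities for the graph and for its dual bound the number of boundary orbits from
above and from below. The Euler formula of the drawing makes the bounds coincide, so both are
equalities. -/
theorem isPlanar_and_card_regions (h : M.IsSpherical) [Nonempty M.V] :
    IsPlanar M.rot Finset.univ ∧ 2 * Fintype.card M.F + (orb M.rot).numClasses =
      2 + (orb (flipOn (Finset.univ : Finset M.E) * M.rot)).numClasses + Fintype.card M.E := by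
  have := M.nonempty_region
  have h1 := euler_edges h.orb_flipOn_univ_le (Finset.empty_subset (Finset.univ : Finset M.E))
  rw [edgeSetoid_empty, bot_sup_eq, bot_sup_eq, numClasses_eq_one h.edgeSetoid_region_univ,
    ← mul_assoc, flipOn_mul_flipOn, one_mul, flipOn_empty, one_mul, numClasses_bot,
    Nat.card_eq_fintype_card, Finset.card_empty, Finset.card_univ] at h1
  have h2 := euler_le M.rot Finset.univ
  rw [Finset.card_univ] at h2
  have h3 := h.card_vertices
  have h4 := h.graphComponents_eq
  have h5 := h.euler
  rw [IsPlanar, Finset.card_univ]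
  omega

end Drawing.IsSpherical

/-! ### The curves of a state as orbits of darts -/

namespace PlanarGraph

open Equiv Setoid Ribbon Drawing
open scoped Classical

variable {n : ℕ} (G : PlanarGraph n)

/-- The darts at the outer vertex. -/
def outerDarts : Set G.Dart := {x | G.vert x = G.outer}

/-- The partition of the darts according to the curve of the state `S` on their left. -/
def curves (S : Finset G.E) : Setoid G.Dart := flow (flipOn S * G.rot) G.outerDarts

/-- A dart whose left side is connected to the boundary point `p`. -/
def boundaryDart (S : Finset G.E) (p : Fin (2 * (2 * n))) : G.Dart :=
  if p.1 % 2 = 1 then G.leg ⟨p.1 / 2, by omega⟩ else flipOn S (G.leg ⟨p.1 / 2, by omega⟩)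

/-- The number of isolated vertices. -/
def numIsolated : ℕ := Nat.card {v : G.V // v ≠ G.outer ∧ G.IsIsolated v}

theorem leg_mem_outerDarts (i : Fin (2 * n)) : G.leg i ∈ G.outerDarts :=
  (G.vert_eq_outer_iff _).2 ⟨i, rfl⟩

theorem exists_leg {x : G.Dart} (h : x ∈ G.outerDarts) : ∃ i, G.leg i = x :=
  (G.vert_eq_outer_iff x).1 h

theorem orb_leg_leg (i j : Fin (2 * n)) : orb G.rot (G.leg i) (G.leg j) :=
  (G.spherical.orb_rot_iff _ _).2
    ((G.leg_mem_outerDarts i).trans (G.leg_mem_outerDarts j).symm)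

variable {G}

/-- Each right end of a strand is joined to the left end of some dart, so darts alone suffice to
describe the curves. -/
theorem quot_connected_mk_false (S : Finset G.E) (x : G.Dart) :
    Quot.mk (G.Connected S) (x, false) = Quot.mk (G.Connected S) (flipOn S x, true) := by
  by_cases hx : x.1 ∈ S
  · have h1 := Connected.parallel (flipOn S x) (S := S) hx
    rw [flipOn_of_mem hx] at h1 ⊢
    have h2 : Drawing.flip ((x.1, !x.2) : G.Dart) = x := by simp [Drawing.flip]
    rw [h2] at h1
    exact (Quot.sound h1).symm
  · rw [flipOn_of_notMem hx]
    exact (Quot.sound (Connected.turnBack x hx)).symm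

/-- The connected pieces of a state correspond to the classes of `curves`. -/
def curvesEquiv (S : Finset G.E) : Quot (G.Connected S) ≃ Quotient (G.curves S) where
  toFun := Quot.lift (fun x => Quotient.mk _ (if x.2 then x.1 else flipOn S x.1)) (by
    rintro _ _ (⟨x, hx⟩ | ⟨x, hx⟩ | ⟨x, hx⟩)
    · have : flipOn S (flip x) = x := by
        rw [flipOn_eq_iff, flipOn_of_mem hx]
        rfl
      simp [this]
    · simp [flipOn_of_notMem hx]
    · simp only [if_true, Bool.false_eq_true, if_false]
      exact Quotient.sound (flow_rel (f := flipOn S * G.rot) hx))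
  invFun := Quotient.lift (fun x => Quot.mk _ (x, true)) (by
    have hle : G.curves S ≤ ker fun x => Quot.mk (G.Connected S) (x, true) := by
      refine flow_le.2 fun x hx => ?_
      rw [ker_def, Perm.mul_apply, ← quot_connected_mk_false]
      exact Quot.sound (Connected.corner x hx)
    exact fun x y hxy => hle hxy)
  left_inv q := by
    induction q using Quot.ind with
    | _ x =>
      obtain ⟨x, b⟩ := x
      cases b
      · exact (quot_connected_mk_false S x).symm
      · rfl
  right_inv q := by
    induction q using Quotient.ind
    rfl

theorem curvesEquiv_boundaryEnd (S : Finset G.E) (p : Fin (2 * (2 * n))) :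
    curvesEquiv S (Quot.mk _ (G.boundaryEnd p)) = Quotient.mk _ (G.boundaryDart S p) := by
  rw [boundaryEnd, boundaryDart]
  change Quotient.mk _ _ = _
  simp

theorem statePairing_eq (S : Finset G.E) :
    G.statePairing S = comap (G.boundaryDart S) (G.curves S) := by
  ext p q
  rw [statePairing, ker_def, ← (curvesEquiv S).apply_eq_iff_eq, curvesEquiv_boundaryEnd,
    curvesEquiv_boundaryEnd, Quotient.eq]
  rfl

theorem stateCircles_eq (S : Finset G.E) :
    G.stateCircles S = freeClasses (G.curves S) (G.boundaryDart S) + G.numIsolated := by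
  rw [stateCircles, numIsolated, freeClasses]
  congr 1
  refine Nat.card_congr ((curvesEquiv S).subtypeEquiv fun c => forall_congr' fun p => ?_)
  rw [← curvesEquiv_boundaryEnd, ne_eq, ne_eq, (curvesEquiv S).apply_eq_iff_eq]

/-- Curves are closed or are arcs, and the arcs are counted by the pairing. Equal pairings thus
reduce a comparison of circles to one of total class numbers. -/
theorem stateCircles_add_numClasses (S : Finset G.E) :
    G.stateCircles S + (G.statePairing S).numClasses =
      (G.curves S).numClasses + G.numIsolated := by
  rw [stateCircles_eq, statePairing_eq, ← freeClasses_add_numClasses_comap (G.curves S)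
    (G.boundaryDart S)]
  omega

/-- The outer vertex carries the `2n` legs, so it is isolated exactly when `n = 0`. -/
theorem card_vertices_eq :
    Fintype.card G.V =
      (orb G.rot).numClasses + G.numIsolated + if n = 0 then 1 else 0 := by
  rw [G.spherical.card_vertices, add_assoc, numIsolated]
  congr 1
  simp only [Nat.card_eq_fintype_card, Fintype.card_subtype]
  have h1 : (Finset.univ.filter fun v => G.IsIsolated v) =
      (Finset.univ.filter fun v => v ≠ G.outer ∧ G.IsIsolated v) ∪
        (Finset.univ.filter fun v => v = G.outer ∧ G.IsIsolated v) := by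
    ext v
    simp only [Finset.mem_filter, Finset.mem_univ, true_and, Finset.mem_union]
    tauto
  rw [h1, Finset.card_union_of_disjoint]
  · congr 1
    split_ifs with hn
    · rw [Finset.card_eq_one]
      refine ⟨G.outer, ?_⟩
      ext v
      simp only [Finset.mem_filter, Finset.mem_univ, true_and, Finset.mem_singleton,
        and_iff_left_iff_imp]
      rintro rfl x hx
      obtain ⟨i, -⟩ := G.exists_leg hx
      have := i.2
      omega
    · rw [Finset.card_eq_zero, Finset.filter_eq_empty_iff]
      rintro _ - ⟨rfl, h⟩
      exact h _ (G.leg_mem_outerDarts ⟨0, by omega⟩)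
  · rw [Finset.disjoint_filter]
    tauto

theorem isPlanar (S : Finset G.E) : IsPlanar G.rot S :=
  have : Nonempty G.V := ⟨G.outer⟩
  G.spherical.isPlanar_and_card_regions.1.mono S.subset_univ

/-! ### The pairing of a state is planar -/

theorem val_finRotate {N : ℕ} (i : Fin N) :
    (finRotate N i).1 = if i.1 + 1 = N then 0 else i.1 + 1 := by
  obtain _ | N := N
  · exact i.elim0
  · rw [finRotate_apply, Fin.val_add_one]
    simp [Fin.ext_iff]

/-- The flow stops at a leg and begins anew at the successor of a leg; `flipOn S (leg j)` is such a
beginning. -/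
theorem flipOn_leg_eq (S : Finset G.E) (i : Fin (2 * n)) :
    flipOn S (G.leg i) = (flipOn S * G.rot) (G.leg ((finRotate (2 * n)).symm i)) := by
  rw [Perm.mul_apply, G.rot_leg, Equiv.apply_symm_apply]

theorem leg_eq_of_curves {S : Finset G.E} {i j : Fin (2 * n)}
    (h : G.curves S (G.leg i) (G.leg j)) : i = j :=
  G.leg_injective (eq_of_flow (G.leg_mem_outerDarts i) (G.leg_mem_outerDarts j) h)

theorem flipOn_leg_eq_of_curves {S : Finset G.E} {i j : Fin (2 * n)}
    (h : G.curves S (flipOn S (G.leg i)) (flipOn S (G.leg j))) : i = j := by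
  rw [flipOn_leg_eq, flipOn_leg_eq] at h
  exact (finRotate (2 * n)).symm.injective (G.leg_injective (eq_of_flow_apply
    (flipOn S * G.rot).injective (G.leg_mem_outerDarts _) (G.leg_mem_outerDarts _) h))

theorem exists_curves_leg (S : Finset G.E) (i : Fin (2 * n)) :
    ∃ j, G.curves S (G.leg i) (flipOn S (G.leg j)) := by
  obtain ⟨x, hx, hxy⟩ := exists_apply_flow (flipOn S * G.rot) (G.leg_mem_outerDarts i)
  obtain ⟨j, rfl⟩ := G.exists_leg hx
  refine ⟨finRotate _ j, ?_⟩
  rw [flipOn_leg_eq, Equiv.symm_apply_apply]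
  exact (G.curves S).symm hxy

theorem exists_curves_flipOn_leg (S : Finset G.E) (j : Fin (2 * n)) :
    ∃ i, G.curves S (G.leg i) (flipOn S (G.leg j)) := by
  obtain ⟨x, hx, hxy⟩ := exists_flow_apply (flipOn S * G.rot)
    (G.leg_mem_outerDarts ((finRotate (2 * n)).symm j))
  obtain ⟨i, rfl⟩ := G.exists_leg hx
  refine ⟨i, ?_⟩
  rw [flipOn_leg_eq]
  exact (G.curves S).symm hxy

theorem boundaryDart_of_odd (S : Finset G.E) {p : Fin (2 * (2 * n))} {i : Fin (2 * n)}
    (h : p.1 = 2 * i.1 + 1) : G.boundaryDart S p = G.leg i := by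
  rw [boundaryDart, if_pos (by omega)]
  congr
  omega

theorem boundaryDart_of_even (S : Finset G.E) {p : Fin (2 * (2 * n))} {i : Fin (2 * n)}
    (h : p.1 = 2 * i.1) : G.boundaryDart S p = flipOn S (G.leg i) := by
  rw [boundaryDart, if_neg (by omega)]
  congr
  omega

theorem exists_odd_or_even (p : Fin (2 * (2 * n))) :
    ∃ i : Fin (2 * n), p.1 = 2 * i.1 + 1 ∨ p.1 = 2 * i.1 :=
  ⟨⟨p.1 / 2, by omega⟩, by simp only; omega⟩

/-- Odd boundary points are ends of the flow and even ones are beginnings, so an arc always joins an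
odd point to an even one. -/
theorem exists_ends {S : Finset G.E} {p q : Fin (2 * (2 * n))} (hpq : p ≠ q)
    (h : G.statePairing S p q) : ∃ i j : Fin (2 * n),
      G.curves S (G.leg i) (flipOn S (G.leg j)) ∧
      (p.1 = 2 * i.1 + 1 ∧ q.1 = 2 * j.1 ∨ q.1 = 2 * i.1 + 1 ∧ p.1 = 2 * j.1) := by
  rw [statePairing_eq, comap_rel] at h
  obtain ⟨i, hi | hi⟩ := exists_odd_or_even p <;> obtain ⟨j, hj | hj⟩ := exists_odd_or_even q
  · rw [boundaryDart_of_odd S hi, boundaryDart_of_odd S hj] at h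
    exact absurd (Fin.ext (by rw [hi, hj, leg_eq_of_curves h])) hpq
  · rw [boundaryDart_of_odd S hi, boundaryDart_of_even S hj] at h
    exact ⟨i, j, h, Or.inl ⟨hi, hj⟩⟩
  · rw [boundaryDart_of_even S hi, boundaryDart_of_odd S hj] at h
    exact ⟨j, i, (G.curves S).symm h, Or.inr ⟨hj, hi⟩⟩
  · rw [boundaryDart_of_even S hi, boundaryDart_of_even S hj] at h
    exact absurd (Fin.ext (by rw [hi, hj, flipOn_leg_eq_of_curves h])) hpq

theorem statePairing_pairing (S : Finset G.E) (p : Fin (2 * (2 * n))) :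
    ∃! q, q ≠ p ∧ G.statePairing S p q := by
  refine existsUnique_of_exists_of_unique ?_ ?_
  · obtain ⟨i, hi | hi⟩ := exists_odd_or_even p
    · obtain ⟨j, hj⟩ := G.exists_curves_leg S i
      refine ⟨⟨2 * j.1, by omega⟩, fun h => ?_, ?_⟩
      · have := congrArg Fin.val h
        simp only at this
        omega
      · rw [statePairing_eq, comap_rel, boundaryDart_of_odd S hi, boundaryDart_of_even S rfl]
        exact hj
    · obtain ⟨j, hj⟩ := G.exists_curves_flipOn_leg S i
      refine ⟨⟨2 * j.1 + 1, by omega⟩, fun h => ?_, ?_⟩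
      · have := congrArg Fin.val h
        simp only at this
        omega
      · rw [statePairing_eq, comap_rel, boundaryDart_of_even S hi, boundaryDart_of_odd S rfl]
        exact (G.curves S).symm hj
  · rintro q r ⟨hq, hpq⟩ ⟨hr, hpr⟩
    by_contra hqr
    have hqr' := (G.statePairing S).trans ((G.statePairing S).symm hpq) hpr
    obtain ⟨i, j, -, h1⟩ := exists_ends hq.symm hpq
    obtain ⟨k, l, -, h2⟩ := exists_ends hr.symm hpr
    obtain ⟨u, v, -, h3⟩ := exists_ends hqr hqr'
    omega

/-- If the ends of two curves are separated by the ends `i`, `j` of another one, then a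
rearrangement of the cyclic order at the outer vertex violates Euler's inequality. -/
theorem not_separated {S : Finset G.E} {i j k l : Fin (2 * n)}
    (hij : G.curves S (G.leg i) (flipOn S (G.leg j)))
    (hkl : G.curves S (G.leg k) (flipOn S (G.leg l))) {I : Set (Fin (2 * n))}
    (hI : ∀ m, m ≠ i → finRotate (2 * n) m ≠ j → (m ∈ I ↔ finRotate (2 * n) m ∈ I))
    (hI' : i ∈ I ↔ j ∈ I)
    (hI'' : (finRotate (2 * n)).symm j ∈ I ↔ finRotate (2 * n) i ∈ I) :
    k ∈ I ↔ l ∈ I := by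
  by_contra hne
  set c := finRotate (2 * n) with hc
  set a := G.leg i with ha
  set b := G.leg (c.symm j) with hb
  -- Cut the outer vertex along the first arc. By the hypotheses on `I`, the new orbits separate the
  -- legs in `I` from the others.
  set ρ := G.rot * swap a b with hρ
  let P : G.Dart → Prop := fun x => ∃ m ∈ I, G.leg m = x
  have hlegI : ∀ m, P (G.leg m) ↔ m ∈ I := fun m =>
    ⟨fun ⟨m', hm, h⟩ => G.leg_injective h ▸ hm, fun h => ⟨m, h, rfl⟩⟩
  have hle : orb ρ ≤ ker P := by
    refine orb_le.2 fun x => propext ?_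
    rw [hρ, Perm.mul_apply]
    by_cases hx : x ∈ G.outerDarts
    · obtain ⟨m, rfl⟩ := G.exists_leg hx
      by_cases hma : m = i
      · subst hma
        rw [swap_apply_left, hb, G.rot_leg, hlegI, ← hc, Equiv.apply_symm_apply, hlegI]
        exact hI'
      · by_cases hmb : m = c.symm j
        · subst hmb
          rw [hb, swap_apply_right, ha, G.rot_leg, hlegI, ← hc, hlegI]
          exact hI''
        · rw [swap_apply_of_ne_of_ne (G.leg_injective.ne hma) (G.leg_injective.ne hmb), G.rot_leg,
            hlegI, hlegI]
          exact hI m hma fun h => hmb (by rw [← h, Equiv.symm_apply_apply])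
    · have hxa : x ≠ a := fun h => hx (h ▸ G.leg_mem_outerDarts _)
      have hxb : x ≠ b := fun h => hx (h ▸ G.leg_mem_outerDarts _)
      rw [swap_apply_of_ne_of_ne hxa hxb]
      refine iff_of_false ?_ ?_
      · rintro ⟨m, -, rfl⟩
        exact hx (G.leg_mem_outerDarts m)
      · rintro ⟨m, -, hm⟩
        refine hx ?_
        have h1 := G.leg_mem_outerDarts m
        rw [hm] at h1
        exact (G.spherical.vert_rot x).symm.trans h1
  set y := ρ.symm (G.leg l) with hy
  have hρy : ρ y = G.leg l := Equiv.apply_symm_apply _ _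
  have hky : ¬ orb ρ (G.leg k) y := by
    intro h
    have h1 := iff_of_eq (hle (Setoid.trans' _ h (hρy ▸ orb_rel ρ y)))
    exact hne ((hlegI k).symm.trans (h1.trans (hlegI l)))
  have hab : a ≠ b := by
    intro h
    have h1 : ρ = G.rot := by rw [hρ, h, swap_self]; rfl
    refine hky ?_
    rw [h1] at hρy ⊢
    exact Setoid.trans' _ (G.orb_leg_leg k l) (Setoid.symm' _ (hρy ▸ orb_rel G.rot y))
  have hOab : orb G.rot a b := G.orb_leg_leg _ _
  have hρle : orb ρ ≤ orb G.rot := by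
    have h1 := orb_mul_swap_sup_pair G.rot a b
    rw [sup_pair_of_rel hOab] at h1
    exact h1 ▸ le_sup_left
  -- Reconnect the two halves at the ends of the second arc; the vertex orbits become those of
  -- `G.rot` again.
  set ρ' := ρ * swap (G.leg k) y with hρ'
  have hky' : orb G.rot (G.leg k) y :=
    Setoid.trans' _ (G.orb_leg_leg k l) (Setoid.symm' _ (hρle (hρy ▸ orb_rel ρ y)))
  have hρ'le : orb ρ' ≤ orb G.rot := by
    have h1 : orb ρ' ≤ orb ρ ⊔ pair (G.leg k) y := by
      rw [← orb_mul_swap_sup_pair]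
      exact le_sup_left
    exact h1.trans (sup_le hρle (pair_le.2 hky'))
  have n1 := numClasses_orb_mul_swap_of_orb hab hOab
  have n2 := numClasses_orb_mul_swap_of_not_orb hky
  rw [← hρ] at n1
  rw [← hρ'] at n2
  have horb : orb ρ' = orb G.rot := (eq_of_le_of_numClasses_le hρ'le (by omega))
  have hπab : orb (flipOn S * G.rot) a b := by
    refine Setoid.trans' _ (flow_le_orb _ _ hij) ?_
    rw [flipOn_leg_eq]
    exact Setoid.symm' _ (orb_rel _ _)
  have hflow : flow (flipOn S * ρ) G.outerDarts = G.curves S := by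
    refine flow_congr fun x hx => ?_
    have hxa : x ≠ a := fun h => hx (h ▸ G.leg_mem_outerDarts _)
    have hxb : x ≠ b := fun h => hx (h ▸ G.leg_mem_outerDarts _)
    rw [hρ, Perm.mul_apply, Perm.mul_apply, swap_apply_of_ne_of_ne hxa hxb, Perm.mul_apply]
  have hπky : orb (flipOn S * ρ) (G.leg k) y := by
    rw [← hflow, ← hρy] at hkl
    exact Setoid.trans' _ (flow_le_orb _ _ hkl) (Setoid.symm' _ (orb_rel _ y))
  have hkyne : G.leg k ≠ y := fun h => hky (h ▸ Setoid.refl' _ _)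
  -- Each of the two changes acts at two darts of one boundary orbit and cuts it in two. So `ρ'` has
  -- two more faces than `G.rot` but the same vertices and components, against `euler_le`.
  have m1 := numClasses_orb_mul_swap_of_orb hab hπab
  have m2 := numClasses_orb_mul_swap_of_orb hkyne hπky
  rw [mul_assoc, ← hρ] at m1
  rw [mul_assoc, ← hρ'] at m2
  have h1 := euler_le ρ' S
  have h2 := G.isPlanar S
  rw [IsPlanar] at h2
  rw [conn, horb, ← conn] at h1
  omega

theorem val_finRotate_symm {N : ℕ} (i : Fin N) :
    ((finRotate N).symm i).1 = if i.1 = 0 then N - 1 else i.1 - 1 := by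
  have h := val_finRotate ((finRotate N).symm i)
  rw [Equiv.apply_symm_apply] at h
  split_ifs at h <;> split_ifs <;> omega

theorem isPlanarPairing_statePairing (S : Finset G.E) : IsPlanarPairing (G.statePairing S) where
  pairing := statePairing_pairing S
  noncrossing := by
    intro a b c d hab hbc hcd hac hbd
    obtain ⟨i, j, hij, h1⟩ := exists_ends (by omega) hac
    obtain ⟨k, l, hkl, h2⟩ := exists_ends (by omega) hbd
    rw [Fin.lt_def] at hab hbc hcd
    have hvi := val_finRotate i
    have hvj := val_finRotate_symm j
    have hi := i.2
    have hj := j.2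
    -- The first arc joins the points `2i + 1` and `2j`, and `I` consists of the legs between them:
    -- `i` and `j` are excluded if `i < j`, and included if `j ≤ i`.
    rcases Nat.lt_or_ge i.1 j.1 with hlt | hge
    · have := not_separated hij hkl (I := {x | i.1 < x.1 ∧ x.1 < j.1}) (by
        intro m hm hm'
        have hv := val_finRotate m
        rw [Ne, Fin.ext_iff] at hm hm'
        have hm := m.2
        simp only [Set.mem_ofPred_eq]
        split_ifs at hv <;> omega) (by simp) (by
        simp only [Set.mem_ofPred_eq]
        split_ifs at hvi hvj <;> omega)
      simp only [Set.mem_ofPred_eq] at this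
      omega
    · have := not_separated hij hkl (I := {x | j.1 ≤ x.1 ∧ x.1 ≤ i.1}) (by
        intro m hm hm'
        have hv := val_finRotate m
        rw [Ne, Fin.ext_iff] at hm hm'
        have hm := m.2
        simp only [Set.mem_ofPred_eq]
        split_ifs at hv <;> omega) (by simp) (by
        simp only [Set.mem_ofPred_eq]
        split_ifs at hvi hvj <;> omega)
      simp only [Set.mem_ofPred_eq] at this
      omega

end PlanarGraph

/-! ### States under deletion and contraction -/

namespace PlanarGraph

open Equiv Setoid Ribbon Drawing
open scoped Classical

variable {n : ℕ} {G H : PlanarGraph n}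

/-- An embedding of the darts of `H` into those of `G` which respects the reversal of darts and
the boundary points. -/
structure DartEmbedding (G H : PlanarGraph n) where
  onDart : H.Dart → G.Dart
  injective : Function.Injective onDart
  flip_eq : ∀ y, onDart (Drawing.flip y) = Drawing.flip (onDart y)
  leg_eq : ∀ i, onDart (H.leg i) = G.leg i

namespace DartEmbedding

variable (j : DartEmbedding G H)

theorem onDart_fst (y : H.Dart) : (j.onDart y).1 = (j.onDart (y.1, true)).1 := by
  obtain ⟨e, b⟩ := y
  cases b
  · have h : (j.onDart (Drawing.flip (e, true))).1 = (Drawing.flip (j.onDart (e, true))).1 :=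
      congrArg Prod.fst (j.flip_eq (e, true))
    exact h
  · rfl

/-- The induced embedding of the edges. -/
def onEdge : H.E ↪ G.E where
  toFun e := (j.onDart (e, true)).1
  inj' e e' h := by
    have h' : j.onDart (e, true) = j.onDart (e', true) ∨
        j.onDart (e, true) = Drawing.flip (j.onDart (e', true)) := by
      rcases h1 : j.onDart (e, true) with ⟨a, b⟩
      rcases h2 : j.onDart (e', true) with ⟨a', b'⟩
      simp only [h1, h2] at h
      subst h
      cases b <;> cases b' <;> simp [Drawing.flip]
    rcases h' with h' | h'
    · exact congrArg Prod.fst (j.injective h')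
    · rw [← j.flip_eq] at h'
      exact congrArg Prod.fst (j.injective h')

theorem onDart_fst_mem_map (S' : Finset H.E) (y : H.Dart) :
    (j.onDart y).1 ∈ S'.map j.onEdge ↔ y.1 ∈ S' := by
  rw [onDart_fst, show (j.onDart (y.1, true)).1 = j.onEdge y.1 from rfl, Finset.mem_map']

theorem onDart_mem_outerDarts (y : H.Dart) :
    j.onDart y ∈ G.outerDarts ↔ y ∈ H.outerDarts := by
  constructor
  · intro h
    obtain ⟨i, hi⟩ := G.exists_leg h
    rw [← j.leg_eq] at hi
    exact j.injective hi ▸ H.leg_mem_outerDarts i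
  · intro h
    obtain ⟨i, rfl⟩ := H.exists_leg h
    rw [j.leg_eq]
    exact G.leg_mem_outerDarts i

theorem preimage_outerDarts : j.onDart ⁻¹' G.outerDarts = H.outerDarts :=
  Set.ext j.onDart_mem_outerDarts

variable {j} {S : Finset G.E} {S' : Finset H.E}

theorem onDart_flipOn (hS : ∀ y, (j.onDart y).1 ∈ S ↔ y.1 ∈ S') (y : H.Dart) :
    j.onDart (flipOn S' y) = flipOn S (j.onDart y) := by
  by_cases h : y.1 ∈ S'
  · rw [flipOn_of_mem h, flipOn_of_mem ((hS y).2 h)]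
    exact j.flip_eq y
  · rw [flipOn_of_notMem h, flipOn_of_notMem (mt (hS y).1 h)]

theorem onDart_boundaryDart (hS : ∀ y, (j.onDart y).1 ∈ S ↔ y.1 ∈ S') (p : Fin (2 * (2 * n))) :
    j.onDart (H.boundaryDart S' p) = G.boundaryDart S p := by
  rw [boundaryDart, boundaryDart]
  split_ifs
  · exact j.leg_eq _
  · rw [onDart_flipOn hS, j.leg_eq]

theorem statePairing_eq_of_comap (hS : ∀ y, (j.onDart y).1 ∈ S ↔ y.1 ∈ S')
    (h : comap j.onDart (G.curves S) = H.curves S') : H.statePairing S' = G.statePairing S := by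
  rw [statePairing_eq, statePairing_eq, ← h, ← funext (onDart_boundaryDart hS)]
  rfl

/-- When `jump` follows the state along `e`, skipping `e` in the cyclic orders amounts to removing
its two darts from the flow. The set `O` is left free so that the same count also serves for vertex
orbits. -/
theorem flow_eq_of_skip {e : G.E} (hS : ∀ y, (j.onDart y).1 ∈ S ↔ y.1 ∈ S')
    (hrange : ∀ x, (∃ y, j.onDart y = x) ↔ x.1 ≠ e) {jump : G.Dart → G.Dart}
    (hjump : ∀ z : G.Dart, z.1 = e → jump z = G.rot (flipOn S z))
    (hrot : ∀ y, j.onDart (H.rot y) = G.skip e jump (G.rot (j.onDart y))) {O : Set G.Dart}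
    (hO : ∀ x ∈ O, x.1 ≠ e) :
    comap j.onDart (flow (flipOn S * G.rot) O) = flow (flipOn S' * H.rot) (j.onDart ⁻¹' O) ∧
      (flow (flipOn S * G.rot) O).numClasses =
        (flow (flipOn S' * H.rot) (j.onDart ⁻¹' O)).numClasses +
          localOrbits (flipOn S * G.rot) (e, true) (e, false) := by
  have hfst : ∀ z : G.Dart, z = (e, true) ∨ z = (e, false) ↔ z.1 = e := by
    rintro ⟨a, b⟩
    cases b <;> simp
  refine flow_remove_two (flipOn S * G.rot).injective (by simp) (fun h => hO _ h rfl)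
    (fun h => hO _ h rfl) j.injective (fun z => ?_)
    (hop := fun z => if z.1 = e then (flipOn S * G.rot) z else z) (fun z => ?_) (fun y => ?_)
  · rw [hrange, ← not_or, hfst]
  · simp only [hfst]
  · rw [Perm.mul_apply, onDart_flipOn hS, hrot, skip, Perm.mul_apply]
    by_cases h1 : (G.rot (j.onDart y)).1 = e
    · rw [if_pos h1, hjump _ h1]
      simp only [flipOn_fst, h1, if_true, Perm.mul_apply]
      by_cases h2 : (G.rot (flipOn S (G.rot (j.onDart y)))).1 = e
      · rw [if_pos h2, if_pos h2, hjump _ h2]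
      · rw [if_neg h2, if_neg h2]
    · simp [h1]

end DartEmbedding

/-- Whether an orbit closes up inside `e` depends only on how the state treats `e`, so it can be
computed in the simplest state. -/
theorem localOrbits_flipOn_congr {S T : Finset G.E} {e : G.E} (h : e ∈ S ↔ e ∈ T) :
    localOrbits (flipOn S * G.rot) (e, true) (e, false) =
      localOrbits (flipOn T * G.rot) (e, true) (e, false) := by
  have h1 : ∀ b, flipOn S (e, b) = flipOn T (e, b) := by
    intro b
    by_cases he : e ∈ S
    · rw [flipOn_of_mem he, flipOn_of_mem (h.1 he)]
    · rw [flipOn_of_notMem he, flipOn_of_notMem (mt h.2 he)]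
  have h2 : ∀ z b, flipOn S z = (e, b) ↔ flipOn T z = (e, b) := fun z b => by
    rw [flipOn_eq_iff, flipOn_eq_iff, h1]
  exact localOrbits_congr (h2 _ _) (h2 _ _) (h2 _ _) (h2 _ _)

theorem IsInner.fst_ne {e : G.E} (he : G.IsInner e) {x : G.Dart} (hx : x ∈ G.outerDarts) :
    x.1 ≠ e := by
  rintro rfl
  exact he x.2 hx

/-- The embedding of the darts which remain after a deletion. -/
def Deletion.toDartEmbedding {e : G.E} (D : G.Deletion e H) : DartEmbedding G H :=
  ⟨D.onDart, D.onDart_injective, D.flip_eq, D.leg_eq⟩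

/-- The embedding of the darts which remain after a contraction. -/
def Contraction.toDartEmbedding {e : G.E} (C : G.Contraction e H) : DartEmbedding G H :=
  ⟨C.onDart, C.onDart_injective, C.flip_eq, C.leg_eq⟩

/-- The embedding of the darts which belongs to an isotopy. -/
def Isotopy.toDartEmbedding (I : G.Isotopy H) : DartEmbedding H G :=
  ⟨I.onDart, I.onDart.injective, I.flip_eq, I.leg_eq⟩

namespace DartEmbedding

variable {j : DartEmbedding G H} {e : G.E}

theorem map_onEdge_univ (hrange : ∀ x, (∃ y, j.onDart y = x) ↔ x.1 ≠ e) :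
    Finset.univ.map j.onEdge = Finset.univ.erase e := by
  ext f
  simp only [Finset.mem_map, Finset.mem_univ, true_and, Finset.mem_erase, and_true]
  constructor
  · rintro ⟨a, rfl⟩
    exact (hrange _).1 ⟨_, rfl⟩
  · intro hf
    obtain ⟨y, hy⟩ := (hrange (f, true)).2 hf
    exact ⟨y.1, (j.onDart_fst y).symm.trans (congrArg Prod.fst hy)⟩

theorem notMem_map_onEdge (hrange : ∀ x, (∃ y, j.onDart y = x) ↔ x.1 ≠ e) (S' : Finset H.E) :
    e ∉ S'.map j.onEdge := by
  intro h
  have := Finset.map_subset_map.2 S'.subset_univ h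
  rw [map_onEdge_univ hrange] at this
  simp at this

theorem card_edges (hrange : ∀ x, (∃ y, j.onDart y = x) ↔ x.1 ≠ e) :
    Fintype.card G.E = Fintype.card H.E + 1 := by
  have h := congrArg Finset.card (map_onEdge_univ hrange)
  rw [Finset.card_map, Finset.card_erase_of_mem (Finset.mem_univ e), Finset.card_univ,
    Finset.card_univ] at h
  have : 0 < Fintype.card G.E := Fintype.card_pos_iff.2 ⟨e⟩
  omega

theorem sum_states {A : Type*} [AddCommMonoid A]
    (hrange : ∀ x, (∃ y, j.onDart y = x) ↔ x.1 ≠ e) (f : Finset G.E → A) :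
    ∑ S, f S = ∑ S' : Finset H.E, (f (S'.map j.onEdge) + f (insert e (S'.map j.onEdge))) := by
  have h1 : (Finset.univ : Finset (Finset G.E)) =
      (insert e (Finset.univ.map j.onEdge)).powerset := by
    rw [map_onEdge_univ hrange, Finset.insert_erase (Finset.mem_univ e), Finset.powerset_univ]
  rw [h1, Finset.sum_powerset_insert (notMem_map_onEdge hrange _), ← Finset.sum_add_distrib]
  symm
  refine Finset.sum_bij (fun S' _ => S'.map j.onEdge)
    (fun S' _ => Finset.mem_powerset.2 (Finset.map_subset_map.2 S'.subset_univ))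
    (fun _ _ _ _ h => Finset.map_injective _ h) (fun S hS => ?_) (fun _ _ => rfl)
  obtain ⟨S', -, rfl⟩ := Finset.subset_map_iff.1 (Finset.mem_powerset.1 hS)
  exact ⟨S', Finset.mem_univ _, rfl⟩

end DartEmbedding

open DartEmbedding

/-- A state with turn-backs along `e` corresponds to a state of `G \ e`. -/
theorem Deletion.state_eq {e : G.E} (D : G.Deletion e H) (he : G.IsInner e) (S' : Finset H.E) :
    G.statePairing (S'.map D.toDartEmbedding.onEdge) = H.statePairing S' ∧
      G.stateCircles (S'.map D.toDartEmbedding.onEdge) + Fintype.card H.V =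
        H.stateCircles S' + Fintype.card G.V := by
  set j := D.toDartEmbedding with hj
  have hrange : ∀ x, (∃ y, j.onDart y = x) ↔ x.1 ≠ e := D.range_onDart
  have key := fun (S' : Finset H.E) (O : Set G.Dart) => flow_eq_of_skip (O := O) (j := j)
    (j.onDart_fst_mem_map S') hrange
    (fun z hz => by rw [flipOn_of_notMem (hz ▸ notMem_map_onEdge hrange S')]) D.rot_eq
  obtain ⟨h1, h2⟩ := key S' G.outerDarts fun _ => he.fst_ne
  -- With no edge in the state and no interruption, the orbits are the vertices of positive valency.
  -- They and the curves lose equally many classes, which covers new isolated vertices and deleted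
  -- closed curves.
  have h3 := (key ∅ ∅ (by simp)).2
  rw [j.preimage_outerDarts] at h1 h2
  rw [localOrbits_flipOn_congr (T := S'.map j.onEdge) (by simp [notMem_map_onEdge hrange]),
    Finset.map_empty, flipOn_empty, flipOn_empty, one_mul, one_mul, Set.preimage_empty] at h3
  have h4 := statePairing_eq_of_comap (j.onDart_fst_mem_map S') h1
  refine ⟨h4.symm, ?_⟩
  have h5 := G.stateCircles_add_numClasses (S'.map j.onEdge)
  have h6 := H.stateCircles_add_numClasses S'
  have h7 := G.card_vertices_eq
  have h8 := H.card_vertices_eq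
  rw [← h4] at h5
  simp only [curves, orb] at *
  omega

theorem Contraction.card_vertices {e : G.E} (C : G.Contraction e H) (he : ¬ G.IsLoop e) :
    Fintype.card G.V = Fintype.card H.V + 1 := by
  have h1 : ker C.onV = ⊥ ⊔ pair (G.vert (e, true)) (G.vert (e, false)) := by
    refine le_antisymm (fun v w hvw => ?_) (sup_le bot_le (pair_le.2 ?_))
    · rcases (C.onV_eq_iff v w).1 hvw with rfl | h
      · exact Setoid.refl' _ _
      · have hp := (le_sup_right : _ ≤ (⊥ : Setoid G.V) ⊔ _)
          (pair_rel (G.vert (e, true)) (G.vert (e, false)))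
        rcases Sym2.eq_iff.1 h with ⟨rfl, rfl⟩ | ⟨rfl, rfl⟩
        · exact hp
        · exact Setoid.symm' _ hp
    · exact (C.onV_eq_iff _ _).2 (Or.inr rfl)
  have h2 := numClasses_ker_of_surjective C.onV_surjective
  rw [h1, Nat.card_eq_fintype_card] at h2
  rw [← h2, ← Nat.card_eq_fintype_card, ← numClasses_bot]
  exact numClasses_eq_sup_pair_add_one he

/-- A state with parallel strands along `e` corresponds to a state of `G / e`. -/
theorem Contraction.state_eq {e : G.E} (C : G.Contraction e H) (he : G.IsInner e)
    (hloop : ¬ G.IsLoop e) (S' : Finset H.E) :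
    G.statePairing (insert e (S'.map C.toDartEmbedding.onEdge)) = H.statePairing S' ∧
      G.stateCircles (insert e (S'.map C.toDartEmbedding.onEdge)) = H.stateCircles S' := by
  set j := C.toDartEmbedding with hj
  have hrange : ∀ x, (∃ y, j.onDart y = x) ↔ x.1 ≠ e := C.range_onDart
  have hS : ∀ (S' : Finset H.E) y, (j.onDart y).1 ∈ insert e (S'.map j.onEdge) ↔ y.1 ∈ S' := by
    intro S' y
    rw [Finset.mem_insert, j.onDart_fst_mem_map, or_iff_right ((hrange _).1 ⟨y, rfl⟩)]
  have key := fun (S' : Finset H.E) (O : Set G.Dart) => flow_eq_of_skip (O := O) (j := j)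
    (hS S') hrange
    (fun z hz => by rw [flipOn_of_mem (hz ▸ Finset.mem_insert_self _ _)]; rfl) C.rot_eq
  obtain ⟨h1, h2⟩ := key S' G.outerDarts fun _ => he.fst_ne
  -- Here the state of `G` is `{e}`: its orbits are the vertices with the ends of `e` merged, and
  -- skipping `e` yields the vertex orbits of `H`.
  have h3 := (key ∅ ∅ (by simp)).2
  rw [j.preimage_outerDarts] at h1 h2
  rw [localOrbits_flipOn_congr (T := insert e (S'.map j.onEdge)) (by simp),
    Finset.map_empty, flipOn_insert (Finset.notMem_empty e), flipOn_empty, flipOn_empty, mul_one,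
    one_mul, Set.preimage_empty] at h3
  have h0 := numClasses_orb_swap_mul_of_not_orb
    (mt (G.spherical.orb_rot_iff (e, true) (e, false)).1 hloop)
  have h4 := statePairing_eq_of_comap (hS S') h1
  refine ⟨h4.symm, ?_⟩
  have h5 := G.stateCircles_add_numClasses (insert e (S'.map j.onEdge))
  have h6 := H.stateCircles_add_numClasses S'
  have h7 := G.card_vertices_eq
  have h8 := H.card_vertices_eq
  have h9 := C.card_vertices hloop
  rw [← h4] at h5
  simp only [curves, orb] at *
  omega

theorem Isotopy.state_eq (I : G.Isotopy H) (S : Finset G.E) :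
    H.statePairing (S.map I.toDartEmbedding.onEdge) = G.statePairing S ∧
      H.stateCircles (S.map I.toDartEmbedding.onEdge) = G.stateCircles S := by
  set j := I.toDartEmbedding with hj
  have hS := j.onDart_fst_mem_map S
  have hsurj : j.onDart.Surjective := I.onDart.surjective
  have h0 : ∀ x, j.onDart ((flipOn S * G.rot) x) =
      (flipOn (S.map j.onEdge) * H.rot) (j.onDart x) := by
    intro x
    rw [Perm.mul_apply, Perm.mul_apply, onDart_flipOn hS]
    exact congrArg _ (I.rot_eq x).symm
  have h1 : comap j.onDart (H.curves (S.map j.onEdge)) = G.curves S := by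
    refine le_antisymm (fun x y hxy => ?_) (flow_le.2 fun x hx => ?_)
    · have hle : H.curves (S.map j.onEdge) ≤ comap I.onDart.symm (G.curves S) := by
        refine flow_le.2 fun z hz => ?_
        obtain ⟨x, rfl⟩ := hsurj z
        rw [← h0, comap_rel]
        change G.curves S (I.onDart.symm (I.onDart _)) (I.onDart.symm (I.onDart _))
        rw [Equiv.symm_apply_apply, Equiv.symm_apply_apply]
        exact flow_rel (f := flipOn S * G.rot) (mt (j.onDart_mem_outerDarts x).2 hz)
      have := hle hxy
      rw [comap_rel] at this
      change G.curves S (I.onDart.symm (I.onDart _)) (I.onDart.symm (I.onDart _)) at this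
      rwa [Equiv.symm_apply_apply, Equiv.symm_apply_apply] at this
    · rw [comap_rel, h0]
      exact flow_rel (mt (j.onDart_mem_outerDarts x).1 hx)
  have h2 : comap j.onDart (orb H.rot) = orb G.rot := by
    ext x y
    rw [comap_rel, H.spherical.orb_rot_iff, G.spherical.orb_rot_iff]
    have hv : ∀ x, H.vert (j.onDart x) = I.onV (G.vert x) := I.vert_eq
    rw [hv, hv, I.onV.apply_eq_iff_eq]
  have h3 := numClasses_comap_of_surjective hsurj (H.curves (S.map j.onEdge))
  have h4 := numClasses_comap_of_surjective hsurj (orb H.rot)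
  rw [h1] at h3
  rw [h2] at h4
  have h5 := statePairing_eq_of_comap hS h1
  refine ⟨h5.symm, ?_⟩
  have h6 := G.stateCircles_add_numClasses S
  have h7 := H.stateCircles_add_numClasses (S.map j.onEdge)
  have h8 := G.card_vertices_eq
  have h9 := H.card_vertices_eq
  rw [← h5] at h7
  have h10 := Fintype.card_congr I.onV
  omega

/-- Merging a closed curve of a state with another curve at the edge of two darts `a`, `b`. -/
theorem state_merge {S T : Finset G.E} {a b : G.Dart} (hT : flipOn T = swap a b * flipOn S)
    (h : ¬ orb (flipOn S * G.rot) a b) (hO : ∀ x ∈ G.outerDarts, ¬ orb (flipOn S * G.rot) a x) :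
    G.statePairing T = G.statePairing S ∧ G.stateCircles S = G.stateCircles T + 1 := by
  obtain ⟨h1, h2⟩ := flow_merge h hO (f := G.boundaryDart S) (g := G.boundaryDart T)
    (fun p => by
      rw [boundaryDart]
      split_ifs
      · exact ⟨_, G.leg_mem_outerDarts _, Setoid.refl' _ _⟩
      · refine ⟨G.leg ((finRotate (2 * n)).symm ⟨p.1 / 2, by omega⟩), G.leg_mem_outerDarts _, ?_⟩
        rw [flipOn_leg_eq]
        exact Setoid.symm' _ (orb_rel _ _))
    (fun p => by
      rw [boundaryDart, boundaryDart]
      split_ifs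
      · exact Or.inl rfl
      · exact Or.inr (by rw [hT, Perm.mul_apply]))
  have hT' : swap a b * (flipOn S * G.rot) = flipOn T * G.rot := by rw [hT, mul_assoc]
  rw [hT'] at h1 h2
  have h3 : G.statePairing T = G.statePairing S := by
    rw [statePairing_eq, statePairing_eq]
    exact h1
  refine ⟨h3, ?_⟩
  have h4 := G.stateCircles_add_numClasses S
  have h5 := G.stateCircles_add_numClasses T
  rw [h3] at h5
  simp only [curves] at *
  omega

/-- By planarity the sides of a loop are different orbits, and at least one of them misses the outer
darts. Turning back along `e` absorbs that closed curve into the other one. -/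
theorem state_eq_of_isLoop {e : G.E} (he : G.IsInner e) (hloop : G.IsLoop e) {S : Finset G.E}
    (heS : e ∉ S) : G.statePairing (insert e S) = G.statePairing S ∧
      G.stateCircles (insert e S) = G.stateCircles S + 1 := by
  have hp := G.isPlanar (insert e S)
  have ho := (G.spherical.orb_rot_iff (e, true) (e, false)).2 hloop
  have h0 := hp.not_orb_of_loop heS ho
  have hflip : flipOn S = swap (e, true) (e, false) * flipOn (insert e S) := by
    rw [flipOn_insert heS, swap_mul_self_mul]
  by_cases h1 : ∀ x ∈ G.outerDarts, ¬ orb (flipOn (insert e S) * G.rot) (e, true) x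
  · obtain ⟨h2, h3⟩ := state_merge hflip h0 h1
    exact ⟨h2.symm, h3⟩
  · push Not at h1
    obtain ⟨a, ha, h1⟩ := h1
    rw [swap_comm] at hflip
    obtain ⟨h2, h3⟩ := state_merge hflip (fun h => h0 (Setoid.symm' _ h)) fun b hb =>
      hp.not_orb_orb heS ho ((G.spherical.orb_rot_iff a b).2 (ha.trans hb.symm)) (fun h => by
        rw [G.spherical.orb_rot_iff] at h
        exact he true (h.symm.trans ha)) h1
    exact ⟨h2.symm, h3⟩

/-- With a turn-back, the end vertex is encircled by a closed curve, seen as a fixed dart; parallel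
strands merge it with another curve. -/
theorem state_eq_of_univalent {x : G.Dart} (hx : G.vert x ≠ G.outer) (hrot : G.rot x = x)
    {S : Finset G.E} (hxS : x.1 ∉ S) :
    G.statePairing (insert x.1 S) = G.statePairing S ∧
      G.stateCircles S = G.stateCircles (insert x.1 S) + 1 := by
  have hfix : (flipOn S * G.rot) x = x := by
    rw [Perm.mul_apply, hrot, flipOn_of_notMem hxS]
  have horb : ∀ y, orb (flipOn S * G.rot) x y → y = x := by
    have hle : orb (flipOn S * G.rot) ≤ ker fun y => y = x := orb_le.2 fun y => propext
      ⟨fun h => by rw [h, hfix], fun h => (flipOn S * G.rot).injective (h.trans hfix.symm)⟩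
    exact fun y hy => (iff_of_eq (hle hy)).1 rfl
  have hflip : flipOn (insert x.1 S) = swap x (x.1, !x.2) * flipOn S := by
    rw [flipOn_insert hxS]
    obtain ⟨e, b⟩ := x
    cases b
    · rw [swap_comm]; rfl
    · rfl
  refine state_merge hflip (fun h => ?_) fun y hy h => hx ((horb y h) ▸ hy)
  have := congrArg Prod.snd (horb _ h)
  simp at this

end PlanarGraph

/-! ### The map `φ` and the relations of the chromatic algebra -/

namespace PlanarGraph

open Equiv Setoid Ribbon Drawing DartEmbedding
open scoped Classical

variable {n : ℕ} {G H K : PlanarGraph n}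

/-! ### Exponents of `d` in the state sum -/

theorem sum_valency (G : PlanarGraph n) :
    ∑ v ∈ Finset.univ.filter (fun v : G.V => v ≠ G.outer), G.valency v + 2 * n =
      2 * Fintype.card G.E := by
  have h1 : ∑ v, G.valency v = 2 * Fintype.card G.E := by
    have h2 : ∀ v, G.valency v = (Finset.univ.filter fun x => G.vert x = v).card := by
      intro v
      rw [valency, Nat.card_eq_fintype_card, Fintype.card_subtype]
    simp only [h2]
    rw [← Finset.card_eq_sum_card_fiberwise (f := G.vert) (s := Finset.univ)
      (t := Finset.univ) (fun _ _ => Finset.mem_coe.2 (Finset.mem_univ _)), Finset.card_univ,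
      Fintype.card_prod, Fintype.card_bool, mul_comm]
  have h3 : G.valency G.outer = 2 * n := by
    rw [valency, ← Nat.card_fin (2 * n)]
    symm
    refine Nat.card_congr (Equiv.ofBijective (fun i => ⟨G.leg i, G.leg_mem_outerDarts i⟩)
      ⟨fun i j h => G.leg_injective (congrArg Subtype.val h), fun ⟨x, hx⟩ => ?_⟩)
    obtain ⟨i, rfl⟩ := G.exists_leg hx
    exact ⟨i, rfl⟩
  rw [← h1, ← Finset.sum_filter_add_sum_filter_not Finset.univ (fun v : G.V => v ≠ G.outer)]
  congr 1
  have h4 : (Finset.univ.filter fun v : G.V => ¬ v ≠ G.outer) = {G.outer} := by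
    ext v
    simp
  rw [h4, Finset.sum_singleton, h3]

theorem prod_cpow {ι : Type*} {d : ℂ} (hd : d ≠ 0) (s : Finset ι) (f : ι → ℂ) :
    ∏ i ∈ s, d ^ f i = d ^ ∑ i ∈ s, f i := by
  induction s using Finset.induction_on with
  | empty => simp
  | insert a s ha ih =>
    rw [Finset.prod_insert ha, Finset.sum_insert ha, ih, Complex.cpow_add _ _ hd]

/-- The valencies of the interior vertices sum to `2|E| - 2n`, so the complex powers combine to an
integral one and the branch of the square root of `d` is irrelevant. -/
theorem vertexFactor_mul_pow {d : ℂ} (hd : d ≠ 0) (G : PlanarGraph n) (c : ℕ) :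
    G.vertexFactor d * d ^ c =
      d ^ ((Fintype.card G.E : ℤ) - n - Fintype.card G.V + 1 + c) := by
  have h1 : G.vertexFactor d = d ^ ((Fintype.card G.E : ℤ) - n - Fintype.card G.V + 1) := by
    rw [vertexFactor, prod_cpow hd, ← Complex.cpow_intCast]
    congr 1
    rw [← Finset.sum_div, Finset.sum_sub_distrib, Finset.sum_const, nsmul_eq_mul]
    have h2 := congrArg (fun m : ℕ => (m : ℂ)) G.sum_valency
    push_cast at h2
    have h3 : ((Finset.univ.filter fun v : G.V => v ≠ G.outer).card : ℂ) =
        Fintype.card G.V - 1 := by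
      rw [Finset.filter_ne', Finset.card_erase_of_mem (Finset.mem_univ _), Finset.card_univ,
        Nat.cast_sub (Fintype.card_pos_iff.2 ⟨G.outer⟩), Nat.cast_one]
    rw [h3, eq_sub_of_add_eq h2]
    push_cast
    ring
  rw [h1, ← zpow_natCast, ← zpow_add₀ hd]

/-- The contribution of the state `S` to `φ`. -/
def stateTerm (G : PlanarGraph n) (d : ℂ) (S : Finset G.E) : Setoid (Fin (2 * (2 * n))) →₀ ℂ :=
  (G.vertexFactor d * (-(1 / d)) ^ (Fintype.card G.E - S.card) * d ^ G.stateCircles S) •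
    Finsupp.single (G.statePairing S) 1

theorem phi_eq_sum (G : PlanarGraph n) (d : ℂ) : G.phi d = ∑ S, G.stateTerm d S := rfl

/-- Both graphs have the same `n`, so its share of the exponent cancels and only edges, vertices and
circles have to be compared. -/
theorem stateTerm_eq_smul {d : ℂ} (hd : d ≠ 0) {S : Finset G.E} {T : Finset H.E} {c : ℂ}
    (hp : G.statePairing S = H.statePairing T)
    (hc : (-(1 / d)) ^ (Fintype.card G.E - S.card) * d ^ ((Fintype.card G.E : ℤ) -
        Fintype.card G.V + G.stateCircles S) =
      c * ((-(1 / d)) ^ (Fintype.card H.E - T.card) * d ^ ((Fintype.card H.E : ℤ) -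
        Fintype.card H.V + H.stateCircles T))) :
    G.stateTerm d S = c • H.stateTerm d T := by
  rw [stateTerm, stateTerm, hp, smul_smul, mul_right_comm, mul_right_comm (H.vertexFactor d),
    vertexFactor_mul_pow hd, vertexFactor_mul_pow hd]
  congr 1
  have e : ∀ E V s : ℤ, E - n - V + 1 + s = (E - V + s) + (1 - n) := fun _ _ _ => by ring
  rw [e, e, zpow_add₀ hd _ (1 - (n : ℤ)), zpow_add₀ hd _ (1 - (n : ℤ))]
  linear_combination d ^ (1 - (n : ℤ)) * hc

/-! ### Isotopy invariance and the three relations -/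

theorem Isotopy.phi_eq {d : ℂ} (hd : d ≠ 0) (I : G.Isotopy H) : G.phi d = H.phi d := by
  have hE : Function.Bijective I.toDartEmbedding.onEdge := by
    refine ⟨I.toDartEmbedding.onEdge.injective, fun f => ?_⟩
    obtain ⟨y, hy⟩ := I.onDart.surjective (f, true)
    exact ⟨y.1, (I.toDartEmbedding.onDart_fst y).symm.trans (congrArg Prod.fst hy)⟩
  have hcard := Fintype.card_of_bijective hE
  rw [phi_eq_sum, phi_eq_sum]
  refine Finset.sum_bij (fun S _ => S.map I.toDartEmbedding.onEdge) (fun _ _ => Finset.mem_univ _)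
    (fun _ _ _ _ h => Finset.map_injective _ h) (fun T _ => ?_) (fun S _ => ?_)
  · refine ⟨T.preimage _ hE.1.injOn, Finset.mem_univ _, ?_⟩
    ext f
    obtain ⟨a, rfl⟩ := hE.2 f
    rw [Finset.mem_map', Finset.mem_preimage]
  · obtain ⟨h1, h2⟩ := I.state_eq S
    rw [← one_smul ℂ (H.stateTerm d _)]
    refine stateTerm_eq_smul hd h1.symm ?_
    rw [h2, Finset.card_map, hcard, Fintype.card_congr I.onV, one_mul]

/-- The edge contributes `-1/d` by its turn-backs and `d` by the vertex exponents, while changes of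
vertices and circles cancel. -/
theorem Deletion.stateTerm_eq {d : ℂ} (hd : d ≠ 0) {e : G.E} (D : G.Deletion e K)
    (he : G.IsInner e) (S : Finset K.E) :
    G.stateTerm d (S.map D.toDartEmbedding.onEdge) = (-1 : ℂ) • K.stateTerm d S := by
  obtain ⟨h1, h2⟩ := D.state_eq he S
  refine stateTerm_eq_smul hd h1 ?_
  have h3 := card_edges (j := D.toDartEmbedding) D.range_onDart
  have h4 := S.card_le_univ
  rw [Finset.card_map, h3, Nat.sub_add_comm h4, pow_succ,
    show ((Fintype.card K.E + 1 : ℕ) : ℤ) - Fintype.card G.V +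
        G.stateCircles (S.map D.toDartEmbedding.onEdge) =
      Fintype.card K.E - Fintype.card K.V + K.stateCircles S + 1 by push_cast; omega,
    zpow_add_one₀ hd]
  field_simp

/-- One edge, which carries no turn-back, and one vertex disappear, so the exponent is unchanged. -/
theorem Contraction.stateTerm_eq {d : ℂ} (hd : d ≠ 0) {e : G.E} (C : G.Contraction e H)
    (he : G.IsInner e) (hloop : ¬ G.IsLoop e) (S : Finset H.E) :
    G.stateTerm d (insert e (S.map C.toDartEmbedding.onEdge)) = H.stateTerm d S := by
  obtain ⟨h1, h2⟩ := C.state_eq he hloop S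
  rw [← one_smul ℂ (H.stateTerm d _)]
  refine stateTerm_eq_smul hd h1 ?_
  have hrange : ∀ x, (∃ y, C.toDartEmbedding.onDart y = x) ↔ x.1 ≠ e := C.range_onDart
  have h3 := card_edges (j := C.toDartEmbedding) hrange
  have h5 := C.card_vertices hloop
  rw [Finset.card_insert_of_notMem (notMem_map_onEdge hrange S), Finset.card_map, h2, h3, h5,
    Nat.add_sub_add_right, one_mul]
  push_cast
  rw [add_sub_add_right_eq_sub]

theorem phi_contract_delete {d : ℂ} (hd : d ≠ 0) {e : G.E} (C : G.Contraction e H)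
    (D : G.Deletion e K) (he : G.IsInner e) (hloop : ¬ G.IsLoop e) :
    G.phi d = H.phi d - K.phi d := by
  have hC : ∀ x, (∃ y, C.toDartEmbedding.onDart y = x) ↔ x.1 ≠ e := C.range_onDart
  have hD : ∀ x, (∃ y, D.toDartEmbedding.onDart y = x) ↔ x.1 ≠ e := D.range_onDart
  have h1 : ∀ S, G.stateTerm d S = (if e ∈ S then G.stateTerm d S else 0) +
      if e ∈ S then 0 else G.stateTerm d S := by
    intro S
    split_ifs <;> simp
  rw [phi_eq_sum, phi_eq_sum, phi_eq_sum, Finset.sum_congr rfl fun S _ => h1 S,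
    Finset.sum_add_distrib, sum_states hC, sum_states hD, sub_eq_add_neg, ← Finset.sum_neg_distrib]
  congr 1
  · refine Finset.sum_congr rfl fun S _ => ?_
    rw [if_neg (notMem_map_onEdge hC S), if_pos (Finset.mem_insert_self _ _), zero_add,
      C.stateTerm_eq hd he hloop]
  · refine Finset.sum_congr rfl fun S _ => ?_
    rw [if_neg (notMem_map_onEdge hD S), if_pos (Finset.mem_insert_self _ _), add_zero,
      D.stateTerm_eq hd he, neg_one_smul]

/-- Parallel strands replace a factor `-1/d` by one more circle, a factor `-d²`. As the turn-back
states give `-φ(G \ e)`, the total is `d² - 1`. -/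
theorem phi_loop {d : ℂ} (hd : d ≠ 0) {e : G.E} (D : G.Deletion e K) (he : G.IsInner e)
    (hloop : G.IsLoop e) : G.phi d = (d ^ 2 - 1) • K.phi d := by
  have hD : ∀ x, (∃ y, D.toDartEmbedding.onDart y = x) ↔ x.1 ≠ e := D.range_onDart
  rw [phi_eq_sum, phi_eq_sum, sum_states hD, Finset.smul_sum]
  refine Finset.sum_congr rfl fun S _ => ?_
  have hS := notMem_map_onEdge hD S
  obtain ⟨h1, h2⟩ := state_eq_of_isLoop he hloop hS
  have h3 : G.stateTerm d (insert e (S.map D.toDartEmbedding.onEdge)) =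
      (-d ^ 2) • G.stateTerm d (S.map D.toDartEmbedding.onEdge) := by
    refine stateTerm_eq_smul hd h1 ?_
    have h3 := card_edges hD
    have h4 := S.card_le_univ
    rw [h2, Finset.card_insert_of_notMem hS, Finset.card_map,
      show Fintype.card G.E - S.card = Fintype.card G.E - (S.card + 1) + 1 by omega,
      pow_succ (-(1 / d)),
      Nat.cast_add, Nat.cast_one, ← add_assoc, zpow_add_one₀ hd]
    field_simp
  rw [h3, D.stateTerm_eq hd he, smul_smul, ← add_smul]
  congr 1
  ring

/-- The turn-back gives `-1/d` and its extra circle gives `d`, so the two states of the edge cancel.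
-/
theorem phi_univalent {d : ℂ} (hd : d ≠ 0) (G : PlanarGraph n) {v : G.V} (hv : v ≠ G.outer)
    (hval : G.valency v = 1) : G.phi d = 0 := by
  rw [valency, Nat.card_eq_one_iff_unique] at hval
  obtain ⟨hsub, ⟨x, rfl⟩⟩ := hval
  have hrot : G.rot x = x := congrArg Subtype.val
    (hsub.elim ⟨G.rot x, G.spherical.vert_rot x⟩ ⟨x, rfl⟩)
  have huniv : (Finset.univ : Finset (Finset G.E)) =
      (insert x.1 (Finset.univ.erase x.1)).powerset := by
    rw [Finset.insert_erase (Finset.mem_univ _), Finset.powerset_univ]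
  rw [phi_eq_sum, huniv, Finset.sum_powerset_insert (by simp), ← Finset.sum_add_distrib]
  refine Finset.sum_eq_zero fun S hS => ?_
  have hxS : x.1 ∉ S := fun h => by simpa using Finset.mem_powerset.1 hS h
  obtain ⟨h1, h2⟩ := state_eq_of_univalent hv hrot hxS
  have h3 : G.stateTerm d S = (-1 : ℂ) • G.stateTerm d (insert x.1 S) := by
    refine stateTerm_eq_smul hd h1.symm ?_
    have h4 := Finset.card_le_univ (insert x.1 S)
    rw [Finset.card_insert_of_notMem hxS] at h4 ⊢
    rw [h2, show Fintype.card G.E - S.card = Fintype.card G.E - (S.card + 1) + 1 by omega,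
      pow_succ, Nat.cast_add, Nat.cast_one, ← add_assoc, zpow_add_one₀ hd]
    field_simp
  rw [h3, neg_one_smul, neg_add_cancel]

theorem phi_mem_temperleyLieb (G : PlanarGraph n) (d : ℂ) : G.phi d ∈ TemperleyLieb (2 * n) :=
  Submodule.sum_mem _ fun S _ => Submodule.smul_mem _ _
    (Finsupp.single_mem_supported ℂ 1 (isPlanarPairing_statePairing S))

end PlanarGraph

/-! ### The closure of a planar graph and the chromatic trace -/

namespace PlanarGraph

open Equiv Setoid Ribbon Drawing
open scoped Classical

variable {n : ℕ} (G : PlanarGraph n)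

/-- The partition of the regions of `G` according to the regions of the closure. -/
def joined : Setoid G.F := gen G.JoinedRegions

theorem region_leg_rotate (i : Fin (2 * n)) :
    G.region (Drawing.flip (G.leg (finRotate (2 * n) i))) = G.region (G.leg i) := by
  rw [← G.rot_leg, G.spherical.region_corner]

theorem flipOn_univ_apply (x : G.Dart) :
    flipOn (Finset.univ : Finset G.E) x = Drawing.flip x :=
  flipOn_of_mem (Finset.mem_univ _)

/-- The first `k` steps in splitting the outer vertex into vertices of valency two which join
opposite boundary points. -/
theorem exists_partial_closure (k : ℕ) (hk : k ≤ n - 1) : ∃ (ρ : Perm G.Dart) (K : Setoid G.F),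
    (∀ x ∉ G.outerDarts, ρ x = G.rot x) ∧
    (∀ i, ρ (G.leg i) = G.leg (if i.1 < k ∨ 2 * n < i.1 + k + 2 then i.rev else
      finRotate (2 * n) i)) ∧
    (orb ρ).numClasses = (orb G.rot).numClasses + k ∧
    orb (flipOn (Finset.univ : Finset G.E) * ρ) ≤ comap G.region K ∧ K ≤ G.joined ∧
    2 * Fintype.card G.F + (orb (flipOn (Finset.univ : Finset G.E) * ρ)).numClasses ≤
      2 * K.numClasses +
        (orb (flipOn (Finset.univ : Finset G.E) * G.rot)).numClasses + k := by
  induction k with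
  | zero =>
    -- At `k = 0` the condition holds only for `i = 2n - 1`, where `rev` and the rotation agree: the
    -- dart that closes the remaining cycle counts as joined from the start.
    refine ⟨G.rot, ⊥, fun _ _ => rfl, fun i => ?_, rfl, G.spherical.orb_flipOn_univ_le, bot_le, ?_⟩
    · rw [G.rot_leg]
      congr 1
      have h1 := val_finRotate i
      have h2 := Fin.val_rev i
      split_ifs with h
      · refine Fin.ext ?_
        split_ifs at h1 <;> omega
      · rfl
    · rw [numClasses_bot, Nat.card_eq_fintype_card]
      omega
  | succ k ih =>
    obtain ⟨ρ, K, h1, h2, h3, h4, h5, h6⟩ := ih (by omega)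
    -- The part not yet split is the cycle of the legs `k, …, 2n - 1 - k`. Cutting it at `k` and `2n
    -- - 2 - k` leaves the outermost two legs as a vertex of valency two.
    let u : Fin (2 * n) := ⟨k, by omega⟩
    let v : Fin (2 * n) := ⟨2 * n - 2 - k, by omega⟩
    have hu : u.1 = k := rfl
    have hv : v.1 = 2 * n - 2 - k := rfl
    have huv : G.leg u ≠ G.leg v := fun h => by
      have := congrArg Fin.val (G.leg_injective h)
      omega
    have hrun : ∀ m (hm : k + m ≤ 2 * n - 2 - k),
        orb ρ (G.leg u) (G.leg ⟨k + m, by omega⟩) := by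
      intro m
      induction m with
      | zero => intro _; exact Setoid.refl' _ _
      | succ m ihm =>
        intro hm
        have h7 := orb_rel ρ (G.leg ⟨k + m, by omega⟩)
        rw [h2, if_neg (by simp only; omega)] at h7
        refine Setoid.trans' _ (ihm (by omega)) ?_
        convert h7 using 2
        refine Fin.ext ?_
        rw [val_finRotate, if_neg (by simp only; omega)]
        rfl
    have horb : orb ρ (G.leg u) (G.leg v) := by
      have h7 := hrun (2 * n - 2 - k - k) (by omega)
      convert h7 using 2
      exact Fin.ext (by simp only [hv]; omega)
    refine ⟨ρ * swap (G.leg u) (G.leg v), K ⊔ pair (G.region (G.leg u)) (G.region (G.leg v)),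
      fun x hx => ?_, fun i => ?_, ?_, ?_, sup_le h5 (pair_le.2 ?_), ?_⟩
    · have hxu : x ≠ G.leg u := fun h => hx (h ▸ G.leg_mem_outerDarts _)
      have hxv : x ≠ G.leg v := fun h => hx (h ▸ G.leg_mem_outerDarts _)
      rw [Perm.mul_apply, swap_apply_of_ne_of_ne hxu hxv, h1 x hx]
    · rw [Perm.mul_apply]
      have hi := i.2
      by_cases hiu : i = u
      · subst hiu
        rw [swap_apply_left, h2, if_neg (by omega), if_pos (by omega)]
        congr 1
        refine Fin.ext ?_
        rw [val_finRotate, Fin.val_rev]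
        split_ifs <;> omega
      · by_cases hiv : i = v
        · subst hiv
          rw [swap_apply_right, h2, if_neg (by omega), if_pos (by omega)]
          congr 1
          refine Fin.ext ?_
          rw [val_finRotate, Fin.val_rev]
          split_ifs <;> omega
        · rw [swap_apply_of_ne_of_ne (G.leg_injective.ne hiu) (G.leg_injective.ne hiv), h2]
          rw [Fin.ext_iff] at hiu hiv
          congr 1
          exact if_congr (by omega) rfl rfl
    · rw [numClasses_orb_mul_swap_of_orb huv horb, h3, add_assoc]
    · rw [← mul_assoc]
      exact euler_step_right_invariant h4 _ _
    -- The region on the left of `leg v` is on the right of the next leg, which is `leg u.rev`, so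
    -- this step identifies the regions along one arc.
    · have h7 : G.joined _ _ := gen_rel (JoinedRegions.arc u)
      have h8 : u.rev = finRotate (2 * n) v := by
        refine Fin.ext ?_
        rw [val_finRotate, Fin.val_rev]
        split_ifs <;> omega
      rwa [h8, region_leg_rotate] at h7
    · have h7 := euler_step_right _ h4 huv
      rw [mul_assoc] at h7
      omega

/-- Splitting the outer vertex into vertices of valency two which join opposite boundary points. -/
theorem exists_closure : ∃ ρ : Perm G.Dart,
    (∀ x ∉ G.outerDarts, ρ x = G.rot x) ∧ (∀ i, ρ (G.leg i) = G.leg i.rev) ∧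
    (orb ρ).numClasses = (orb G.rot).numClasses + (n - 1) ∧
    orb (flipOn (Finset.univ : Finset G.E) * ρ) ≤ comap G.region G.joined ∧
    2 * Fintype.card G.F + (orb (flipOn (Finset.univ : Finset G.E) * ρ)).numClasses ≤
      2 * G.joined.numClasses +
        (orb (flipOn (Finset.univ : Finset G.E) * G.rot)).numClasses + (n - 1) := by
  obtain ⟨ρ, K, h1, h2, h3, h4, h5, h6⟩ := G.exists_partial_closure (n - 1) le_rfl
  have h7 : ∀ i, ρ (G.leg i) = G.leg i.rev := by
    intro i
    rw [h2]
    congr 1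
    have hi := i.2
    have h8 := val_finRotate i
    have h9 := Fin.val_rev i
    split_ifs with h
    · rfl
    · refine Fin.ext ?_
      split_ifs at h8 <;> omega
  -- The boundary permutation of `ρ` runs along every arc, so its invariance already forces all the
  -- identifications.
  have hK : K = G.joined := by
    refine le_antisymm h5 (gen_le.2 ?_)
    rintro _ _ ⟨i⟩
    have h8 := h4 (orb_rel (flipOn (Finset.univ : Finset G.E) * ρ) (G.leg i))
    rwa [Perm.mul_apply, h7, flipOn_univ_apply] at h8
  subst hK
  exact ⟨ρ, h1, h7, h3, h4, h6⟩

theorem joined_sup_edgeSetoid_univ (f g : G.F) :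
    (G.joined ⊔ edgeSetoid G.region (Finset.univ : Finset G.E)) f g :=
  (le_sup_right : edgeSetoid G.region (Finset.univ : Finset G.E) ≤ _)
    (G.spherical.edgeSetoid_region_univ f g)

/-- Euler's formula for the states of the closure. -/
theorem numClasses_closure {ρ : Perm G.Dart}
    (h3 : (orb ρ).numClasses = (orb G.rot).numClasses + (n - 1))
    (h4 : orb (flipOn (Finset.univ : Finset G.E) * ρ) ≤ comap G.region G.joined)
    (h5 : 2 * Fintype.card G.F + (orb (flipOn (Finset.univ : Finset G.E) * ρ)).numClasses ≤
      2 * G.joined.numClasses +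
        (orb (flipOn (Finset.univ : Finset G.E) * G.rot)).numClasses + (n - 1))
    (S : Finset G.E) :
    2 * (G.joined ⊔ edgeSetoid G.region Sᶜ).numClasses + (orb G.rot).numClasses + (n - 1) =
      2 + (orb (flipOn S * ρ)).numClasses + S.card := by
  have : Nonempty G.V := ⟨G.outer⟩
  have := G.nonempty_region
  have hS : flipOn Sᶜ * (flipOn (Finset.univ : Finset G.E) * ρ) = flipOn S * ρ := by
    refine Equiv.ext fun x => ?_
    rw [Perm.mul_apply, Perm.mul_apply, Perm.mul_apply, flipOn_univ_apply]
    by_cases hx : (ρ x).1 ∈ S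
    · rw [flipOn_of_mem hx, flipOn_of_notMem (by simpa [Drawing.flip] using hx)]
      rfl
    · rw [flipOn_of_notMem hx, flipOn_of_mem (by simpa [Drawing.flip] using hx)]
      simp [Drawing.flip]
  -- Going from no dual edge to `Sᶜ`, and from `Sᶜ` to all edges, gives opposite inequalities. They
  -- meet because the full dual graph is connected and the count for the drawing is exact.
  have e1 := euler_edges h4 Sᶜ.empty_subset
  have e2 := euler_edges h4 Sᶜ.subset_univ
  have e3 := G.spherical.isPlanar_and_card_regions.2
  have e4 : S.card + Sᶜ.card = Fintype.card G.E := Finset.card_add_card_compl S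
  rw [edgeSetoid_empty, sup_bot_eq, hS, flipOn_empty, one_mul, Finset.card_empty] at e1
  rw [hS, numClasses_eq_one G.joined_sup_edgeSetoid_univ, ← mul_assoc, flipOn_mul_flipOn, one_mul,
    Finset.card_univ] at e2
  omega

/-- Where the flow stops at `leg i`, `ρ` carries it through the outside arc to its new beginning at
`leg i.rev`; the interruptions are thereby removed. -/
theorem curves_sup_gen {ρ : Perm G.Dart} (h1 : ∀ x ∉ G.outerDarts, ρ x = G.rot x)
    (h2 : ∀ i, ρ (G.leg i) = G.leg i.rev) (S : Finset G.E) :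
    (G.curves S ⊔ gen fun x y => ∃ p q : Fin (2 * (2 * n)), q = p.rev ∧
      G.boundaryDart S p = x ∧ G.boundaryDart S q = y) = orb (flipOn S * ρ) := by
  have hc : G.curves S = flow (flipOn S * ρ) G.outerDarts :=
    flow_congr fun x hx => by rw [Perm.mul_apply, Perm.mul_apply, h1 x hx]
  have hleg : ∀ i, (flipOn S * ρ) (G.leg i) = flipOn S (G.leg i.rev) := fun i => by
    rw [Perm.mul_apply, h2]
  refine le_antisymm (sup_le (hc ▸ flow_le_orb _ _) (gen_le.2 ?_)) (orb_le.2 fun x => ?_)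
  · rintro _ _ ⟨p, _, rfl, rfl, rfl⟩
    obtain ⟨i, hi | hi⟩ := exists_odd_or_even p
    · rw [boundaryDart_of_odd S hi, boundaryDart_of_even S (i := i.rev), ← hleg]
      · exact orb_rel _ _
      · rw [Fin.val_rev, Fin.val_rev]
        omega
    · rw [boundaryDart_of_even S hi, boundaryDart_of_odd S (i := i.rev)]
      · have h3 := orb_rel (flipOn S * ρ) (G.leg i.rev)
        rw [hleg, Fin.rev_rev] at h3
        exact Setoid.symm' _ h3
      · rw [Fin.val_rev, Fin.val_rev]
        omega
  · by_cases hx : x ∈ G.outerDarts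
    · obtain ⟨i, rfl⟩ := G.exists_leg hx
      refine (le_sup_right : gen _ ≤ _) (gen_rel ⟨⟨2 * i.1 + 1, by omega⟩, _, rfl, ?_, ?_⟩)
      · exact boundaryDart_of_odd S rfl
      · rw [hleg]
        refine boundaryDart_of_even S ?_
        rw [Fin.val_rev, Fin.val_rev]
        simp only
        omega
    · exact (le_sup_left : G.curves S ≤ _) (hc ▸ flow_rel hx)

theorem stateCircles_add_closureLoops {ρ : Perm G.Dart}
    (h1 : ∀ x ∉ G.outerDarts, ρ x = G.rot x) (h2 : ∀ i, ρ (G.leg i) = G.leg i.rev)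
    (S : Finset G.E) :
    G.stateCircles S + closureLoops (G.statePairing S) =
      (orb (flipOn S * ρ)).numClasses + G.numIsolated := by
  rw [← G.curves_sup_gen h1 h2, numClasses_sup_gen_map (G.curves S) (G.boundaryDart S)
    fun p q => q = p.rev, stateCircles_eq, closureLoops, card_quot, ← statePairing_eq]
  have h3 : (gen fun i j => G.statePairing S i j ∨ j = i.rev) =
      G.statePairing S ⊔ gen fun i j => j = i.rev := by
    refine le_antisymm (gen_le.2 fun i j h => ?_) (sup_le (fun i j h => gen_rel (Or.inl h))
      (gen_le.2 fun i j h => gen_rel (Or.inr h)))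
    rcases h with h | h
    · exact (le_sup_left : G.statePairing S ≤ _) h
    · exact (le_sup_right : gen (fun i j : Fin (2 * (2 * n)) => j = i.rev) ≤ _) (gen_rel h)
  rw [h3]
  omega

/-- The dual graph of the drawing obtained from `G` by joining opposite boundary points at
vertices of valency two. -/
def subdividedClosureDual : Multigraph :=
  letI := Fintype.ofFinite (Quot G.JoinedRegions)
  { V := Quot G.JoinedRegions
    E := G.E
    ends := fun e => s(Quot.mk G.JoinedRegions (G.region (e, true)),
      Quot.mk G.JoinedRegions (G.region (e, false))) }

theorem components_subdividedClosureDual (T : Finset G.E) :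
    G.subdividedClosureDual.components T =
      (G.joined ⊔ edgeSetoid G.region T).numClasses := by
  let L := G.joined ⊔ edgeSetoid G.region T
  let q : G.F → Quot G.JoinedRegions := Quot.mk _
  have hq : q.Surjective := Quot.mk_surjective
  let r : Quot G.JoinedRegions → Quot G.JoinedRegions → Prop :=
    fun a b => ∃ e ∈ T, s(q (G.region (e, true)), q (G.region (e, false))) = s(a, b)
  have h : comap q (gen r) = L := by
    refine le_antisymm (fun f g hfg => ?_) (sup_le (gen_le.2 fun f g hfg => ?_)
      (edgeSetoid_le.2 fun e he => gen_rel ⟨e, he, rfl⟩))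
    · let l : Quot G.JoinedRegions → Quotient L := Quot.lift (Quotient.mk L) fun a b hab =>
        Quotient.sound ((le_sup_left : G.joined ≤ L) (gen_rel hab))
      have hle : gen r ≤ ker l := by
        refine gen_le.2 ?_
        rintro a b ⟨e, he, hab⟩
        have h1 : l (q (G.region (e, true))) = l (q (G.region (e, false))) :=
          Quotient.sound ((le_sup_right : edgeSetoid G.region T ≤ L) (edgeSetoid_rel _ he))
        rcases Sym2.eq_iff.1 hab with ⟨rfl, rfl⟩ | ⟨rfl, rfl⟩
        · exact h1
        · exact h1.symm
      exact Quotient.exact (hle hfg)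
    · rw [comap_rel, show q f = q g from Quot.sound hfg]
  change Nat.card (Quot r) = _
  rw [card_quot, ← numClasses_comap_of_surjective hq, h]

theorem eval_chromaticPolynomial_subdividedClosureDual (Q : ℂ) :
    G.subdividedClosureDual.chromaticPolynomial.eval Q =
      ∑ T : Finset G.E, (-1) ^ T.card * Q ^ (G.joined ⊔ edgeSetoid G.region T).numClasses := by
  rw [Multigraph.chromaticPolynomial, eval_finsetSum]
  refine Finset.sum_congr rfl fun (T : Finset G.E) _ => ?_
  rw [eval_mul, eval_pow, eval_pow, eval_neg, eval_one, eval_X]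
  exact congrArg (fun k => (-1) ^ T.card * Q ^ k) (G.components_subdividedClosureDual T)

/-! ### Comparison of chromatic polynomials by colourings -/

theorem chromaticPolynomial_eq_of_card {Γ Δ : Multigraph}
    (h : ∀ m, Nat.card {c : Γ.V → Fin m // Γ.IsProperColoring c} =
      Nat.card {c : Δ.V → Fin m // Δ.IsProperColoring c}) :
    Γ.chromaticPolynomial = Δ.chromaticPolynomial := by
  refine Polynomial.eq_of_infinite_eval_eq _ _ ?_
  refine (Set.infinite_range_of_injective (Nat.cast_injective (R := ℂ))).mono ?_
  rintro _ ⟨m, rfl⟩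
  change Polynomial.eval _ _ = Polynomial.eval _ _
  rw [Multigraph.chromaticPolynomial_eval_natCast, Multigraph.chromaticPolynomial_eval_natCast, h]

/-- Legs joined by an arc are separate edges in the subdivided drawing. In the dual they become
parallel edges, which impose the same condition on colourings. -/
theorem chromaticPolynomial_closureDual :
    G.closureDual.chromaticPolynomial = G.subdividedClosureDual.chromaticPolynomial := by
  refine chromaticPolynomial_eq_of_card fun m => Nat.card_congr
    (Equiv.subtypeEquivRight fun c => ?_)
  exact ⟨fun h e => h (Quot.mk _ e), fun h => Quot.ind h⟩

theorem chromaticPolynomial_closureDual_zero (G : PlanarGraph 0) :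
    G.closureDual.chromaticPolynomial = G.dual.chromaticPolynomial := by
  rw [chromaticPolynomial_closureDual]
  have hq : Function.Bijective (Quot.mk G.JoinedRegions) := by
    refine ⟨fun f g h => ?_, Quot.mk_surjective⟩
    have h1 : gen G.JoinedRegions ≤ ⊥ := gen_le.2 (by
      rintro _ _ ⟨i⟩
      exact i.elim0)
    exact h1 (Quot.eqvGen_exact h)
  refine chromaticPolynomial_eq_of_card fun m => Nat.card_congr
    (((Equiv.ofBijective _ hq).arrowCongr (Equiv.refl (Fin m))).subtypeEquiv fun c => ?_).symm
  refine forall_congr' fun e => ?_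
  have h1 : ∀ f, (((Equiv.ofBijective _ hq).arrowCongr (Equiv.refl (Fin m))) c)
      (Quot.mk G.JoinedRegions f) = c f := fun f => by
    rw [Equiv.arrowCongr_apply]
    exact congrArg c ((Equiv.ofBijective _ hq).symm_apply_apply f)
  change ¬ (Sym2.map c s(G.region (e, true), G.region (e, false))).IsDiag ↔
    ¬ (Sym2.map _ s(Quot.mk G.JoinedRegions (G.region (e, true)),
      Quot.mk G.JoinedRegions (G.region (e, false)))).IsDiag
  rw [Sym2.map_mk, Sym2.map_mk, h1, h1]

/-- The trace of `φ(G)` is the chromatic trace of `G`. -/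
theorem loopTrace_phi {d : ℂ} (hd : d ≠ 0) :
    loopTrace d (2 * n) (G.phi d) = G.chromaticTrace (d ^ 2) := by
  obtain ⟨ρ, h1, h2, h3, h4, h5⟩ := G.exists_closure
  rw [chromaticTrace, chromaticPolynomial_closureDual,
    eval_chromaticPolynomial_subdividedClosureDual, phi, map_sum, Finset.mul_sum]
  -- A state turns back exactly along the edges that its dual subgraph uses.
  refine Finset.sum_bij (fun S _ => Sᶜ) (fun _ _ => Finset.mem_univ _)
    (fun _ _ _ _ h => compl_injective h) (fun T _ => ⟨Tᶜ, Finset.mem_univ _, compl_compl T⟩)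
    fun S _ => ?_
  rw [map_smul, loopTrace, Finsupp.linearCombination_single, one_smul, smul_eq_mul,
    mul_right_comm, mul_right_comm, mul_assoc (_ * _), ← pow_add, mul_right_comm,
    vertexFactor_mul_pow hd]
  have e1 := G.numClasses_closure h3 h4 h5 S
  have e2 := G.stateCircles_add_closureLoops h1 h2 S
  have e3 := G.card_vertices_eq
  have e4 : S.card + Sᶜ.card = Fintype.card G.E := Finset.card_add_card_compl S
  have e5 : Fintype.card G.E - S.card = Sᶜ.card := by omega
  rw [e5]
  generalize (orb (flipOn S * ρ)).numClasses = m at e1 e2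
  generalize (G.joined ⊔ edgeSetoid G.region Sᶜ).numClasses = k at e1 ⊢
  -- For `n = 0` the truncated `n - 1` is `0`, and the isolated outer vertex, which is not
  -- encircled, makes up the difference; so one formula covers all `n`.
  have e6 : (Fintype.card G.E : ℤ) - n - Fintype.card G.V + 1 +
      ((G.stateCircles S + closureLoops (G.statePairing S) : ℕ) : ℤ) =
      Sᶜ.card + (2 * k - 2 : ℤ) := by
    rw [e2]
    split_ifs at e3 <;> push_cast <;> omega
  rw [e6, zpow_add₀ hd, zpow_natCast, zpow_sub₀ hd]
  have e7 : d ^ (2 * (k : ℤ)) = (d ^ 2) ^ k := by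
    rw [← pow_mul]
    exact_mod_cast zpow_natCast d (2 * k)
  have e8 : (-1 : ℂ) ^ Sᶜ.card = d ^ Sᶜ.card * (-(1 / d)) ^ Sᶜ.card := by
    rw [← mul_pow, mul_neg, mul_one_div_cancel hd]
  rw [e7, e8, zpow_ofNat]
  ring

end PlanarGraph

/-! ### The induced maps on the chromatic algebra -/

/-- The linear extension of `φ` to the free vector space. -/
def phiFree (d : ℂ) (hd : d ≠ 0) (n : ℕ) : FreeGraphs n →ₗ[ℂ] TemperleyLieb (2 * n) :=
  Finsupp.linearCombination ℂ (Quot.lift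
    (fun G : PlanarGraph n => (⟨G.phi d, G.phi_mem_temperleyLieb d⟩ : TemperleyLieb (2 * n)))
    fun _ _ ⟨I⟩ => Subtype.ext (I.phi_eq hd))

theorem phiFree_toFree {d : ℂ} (hd : d ≠ 0) {n : ℕ} (G : PlanarGraph n) :
    (phiFree d hd n G.toFree : Setoid (Fin (2 * (2 * n))) →₀ ℂ) = G.phi d :=
  congrArg Subtype.val ((Finsupp.linearCombination_single ℂ (1 : ℂ)
    (Quot.mk _ G : GraphClass n)).trans (one_smul ℂ _))

theorem phiFree_eq_zero {d : ℂ} (hd : d ≠ 0) {n : ℕ} {a : FreeGraphs n}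
    (ha : ChromaticRelation (d ^ 2) a) : phiFree d hd n a = 0 := by
  refine Subtype.ext ?_
  cases ha with
  | contract_delete G H K e he hloop hC hD =>
    obtain ⟨C⟩ := hC
    obtain ⟨D⟩ := hD
    rw [map_sub, map_sub, Submodule.coe_sub, Submodule.coe_sub, phiFree_toFree, phiFree_toFree,
      phiFree_toFree, PlanarGraph.phi_contract_delete hd C D he hloop, sub_self, Submodule.coe_zero]
  | loop G K e he hloop hD =>
    obtain ⟨D⟩ := hD
    rw [map_sub, map_smul, Submodule.coe_sub, Submodule.coe_smul, phiFree_toFree, phiFree_toFree,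
      PlanarGraph.phi_loop hd D he hloop, sub_self, Submodule.coe_zero]
  | univalent G v hv hval =>
    rw [phiFree_toFree, G.phi_univalent hd hv hval, Submodule.coe_zero]

/-- The linear map induced by `φ` on the chromatic algebra. -/
def phiChromatic (d : ℂ) (hd : d ≠ 0) (n : ℕ) :
    ChromaticAlgebra (d ^ 2) n →ₗ[ℂ] TemperleyLieb (2 * n) :=
  Submodule.liftQ (M₂ := TemperleyLieb (2 * n)) (τ₁₂ := RingHom.id ℂ) (chromaticIdeal (d ^ 2) n)
    (phiFree d hd n) <| by
      refine Submodule.span_le.2 fun a ha => ?_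
      exact phiFree_eq_zero hd ha

theorem phiChromatic_toChromatic {d : ℂ} (hd : d ≠ 0) {n : ℕ} (G : PlanarGraph n) :
    (phiChromatic d hd n (G.toChromatic (d ^ 2)) : Setoid (Fin (2 * (2 * n))) →₀ ℂ) = G.phi d :=
  phiFree_toFree hd G

end

theorem mainTheorem6 (d : ℂ) (hd : d ≠ 0) :
    (∀ G : PlanarGraph 0,
      G.chromaticTrace (d ^ 2) = (d ^ 2)⁻¹ * G.dual.chromaticPolynomial.eval (d ^ 2) ∧
      (d ^ 2)⁻¹ * G.dual.chromaticPolynomial.eval (d ^ 2) = loopTrace d (2 * 0) (G.phi d)) ∧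
    ∀ n : ℕ, ∃ (φ : ChromaticAlgebra (d ^ 2) n →ₗ[ℂ] TemperleyLieb (2 * n))
        (tr : ChromaticAlgebra (d ^ 2) n →ₗ[ℂ] ℂ),
      (∀ G : PlanarGraph n,
        (φ (G.toChromatic (d ^ 2)) : Setoid (Fin (2 * (2 * n))) →₀ ℂ) = G.phi d) ∧
      (∀ G : PlanarGraph n, tr (G.toChromatic (d ^ 2)) = G.chromaticTrace (d ^ 2)) ∧
      ∀ a : ChromaticAlgebra (d ^ 2) n, tr a = loopTrace d (2 * n) (φ a) := by
  refine ⟨fun G => ?_, fun n => ?_⟩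
  · have h : G.chromaticTrace (d ^ 2) =
        (d ^ 2)⁻¹ * G.dual.chromaticPolynomial.eval (d ^ 2) := by
      rw [PlanarGraph.chromaticTrace, PlanarGraph.chromaticPolynomial_closureDual_zero]
    exact ⟨h, by rw [← h, G.loopTrace_phi hd]⟩
  -- The trace is defined as the loop trace after φ, so it respects the relations automatically;
  -- `loopTrace_phi` identifies it on graphs.
  · refine ⟨phiChromatic d hd n,
      (loopTrace d (2 * n) ∘ₗ (TemperleyLieb (2 * n)).subtype) ∘ₗ phiChromatic d hd n,
      phiChromatic_toChromatic hd, fun G => ?_, fun a => rfl⟩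
    exact (congrArg (loopTrace d (2 * n)) (phiChromatic_toChromatic hd G)).trans
      (G.loopTrace_phi hd)
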